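/- Let $k,n\ge 0$ be integers and $0<c<1$. Let $v_n$ be the last vector of the standard basis $v_0,\dots,v_n$ of $\mathbb R^{n+1}$, and identify $\mathbb R^n$ with $\langle v_n\rangle^\perp\subset\mathbb R^{n+1}$. For a $k$-dimensional subspace $L\subset\mathbb C^{n+1}$ with Plücker coordinates $w_I$, $I=(i_1<\dots<i_k)$, $0\le i_j\le n$, put $$F(\mu_n)(L)=\frac{\sum_{I\ni n}|w_I|^2}{\sum_{I}|w_I|^2}.$$ Let $N(c)=\{F(\mu_n)=c\}\subset \mathrm{Gr}(k,n+1)$ and let $S_{\mathbb R}(c)=N(c)\cap \mathrm{Gr}_{\mathbb R}(k,n+1)$ be the set of real $k$-dimensional subspaces of $\mathbb R^{n+1}$ whose complexification lies in $N(c)$. Let $\tau\to\mathrm{Gr}_{\mathbb R}(k,n)$ be the tautological bundle, whose fibre at $L_0$ is $L_0\subset\mathbb R^n$ with the induced Euclidean norm, let $\tau^*$ be its dual, and let $S^{k-1}(\tau^*)$ be the bundle of linear functionals of norm $1$. Then: 1. $S_{\mathbb R}(c)$ is a smooth embedded hypersurface of $\mathrm{Gr}_{\mathbb R}(k,n+1)$,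 the total space $\mathrm{tot}(S^{k-1}(\tau^*)\to\mathrm{Gr}_{\mathbb R}(k,n))$ is a smooth embedded hypersurface of $\mathrm{tot}(\tau^*)$, and the two are diffeomorphic. The diffeomorphism can be chosen so that if $L$ corresponds to $(L_0,\varphi)$, with $L_0\in \mathrm{Gr}_{\mathbb R}(k,n)$ and $\varphi\in L_0^*$, $\|\varphi\|=1$, then $L\subset\mathbb R\langle v_n\rangle\oplus L_0$ and $L\cap L_0=\ker\varphi$. 2. A $k$-dimensional subspace $L\subset\mathbb R^{n+1}$ belongs to $S_{\mathbb R}(c)$ if and only if the angle between $v_n$ and $L$ (the angle between $v_n$ and its orthogonal projection to $L$, a right angle if this projection is zero) equals $\arccos\sqrt c$. 3. For every $k$-dimensional subspace $L_0\subset\langle v_n\rangle^\perp$ and every $(k-1)$-dimensional subspace $M\subset L_0$ there are exactly two $k$-dimensional subspaces $L\subset\mathbb R\langle v_n\rangle\oplus L_0$ that contain $M$ and whose angle to $v_n$ equals $\arccos\sqrt c$. (If $k=0$ or $k>n$, both manifolds in 1 are empty and 3 is vacuous.) -/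

import Mathlib

open scoped Manifold ContDiff Bundle Topology

noncomputable section

/-- The Grassmannian `Gr_𝕜(k, m)` of `k`-dimensional linear subspaces of `𝕜^m`. -/
def Gr (𝕜 : Type) [RCLike 𝕜] (k m : ℕ) : Type :=
  {L : Submodule 𝕜 (EuclideanSpace 𝕜 (Fin m)) // Module.finrank 𝕜 L = k}

/-! ### The real Grassmannian as a smooth manifold -/

namespace Gr

variable {k m : ℕ}

/-- The model space `Hom(ℝ^k, ℝ^(m-k))` of the real Grassmannian `Gr_ℝ(k, m)`. -/
abbrev Model (k m : ℕ) : Type :=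
  EuclideanSpace ℝ (Fin k) →L[ℝ] EuclideanSpace ℝ (Fin (m - k))

/-- Linear coordinates on `ℝ^m` split into a block of `k` and a block of `m - k` coordinates. -/
abbrev Frame (k m : ℕ) : Type :=
  (EuclideanSpace ℝ (Fin k) × EuclideanSpace ℝ (Fin (m - k))) ≃L[ℝ] EuclideanSpace ℝ (Fin m)

/-- The linear map `y ↦ e (y, A y)`. -/
def graphMap (e : Frame k m) (A : Model k m) :
    EuclideanSpace ℝ (Fin k) →L[ℝ] EuclideanSpace ℝ (Fin m) :=
  e.toContinuousLinearMap ∘L ((ContinuousLinearMap.id ℝ _).prod A)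

@[simp] theorem graphMap_apply (e : Frame k m) (A : Model k m) (y : EuclideanSpace ℝ (Fin k)) :
    graphMap e A y = e (y, A y) := rfl

theorem graphMap_injective (e : Frame k m) (A : Model k m) :
    Function.Injective (graphMap e A) := by
  intro y y' h
  have := e.injective h
  exact congrArg Prod.fst this

/-- The `k`-dimensional subspace of `ℝ^m` that is the graph of `A` in the linear coordinates
`e`. -/
def graphPt (e : Frame k m) (A : Model k m) : Gr ℝ k m :=
  ⟨LinearMap.range (graphMap e A).toLinearMap, by
    rw [LinearMap.finrank_range_of_inj (graphMap_injective e A)]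
    simp⟩

theorem mem_graphPt_iff_exists {e : Frame k m} {A : Model k m} {x : EuclideanSpace ℝ (Fin m)} :
    x ∈ (graphPt e A).1 ↔ ∃ y, e (y, A y) = x := LinearMap.mem_range

theorem mem_graphPt {e : Frame k m} {A : Model k m} {x : EuclideanSpace ℝ (Fin m)} :
    x ∈ (graphPt e A).1 ↔ (e.symm x).2 = A (e.symm x).1 := by
  rw [mem_graphPt_iff_exists]
  constructor
  · rintro ⟨y, rfl⟩
    simp
  · intro h
    refine ⟨(e.symm x).1, ?_⟩
    have : ((e.symm x).1, A (e.symm x).1) = e.symm x := by rw [← h]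
    simp [this]

theorem apply_mem_graphPt (e : Frame k m) (A : Model k m) (y : EuclideanSpace ℝ (Fin k)) :
    e (y, A y) ∈ (graphPt e A).1 := mem_graphPt_iff_exists.2 ⟨y, rfl⟩

theorem graphPt_injective (e : Frame k m) : Function.Injective (graphPt (k := k) (m := m) e) := by
  intro A B h
  ext1 y
  have h1 := apply_mem_graphPt e A y
  rw [h, mem_graphPt] at h1
  simpa using h1

/-- The affine chart attached to linear coordinates `e`: its domain is the set of subspaces that
are graphs `{e (y, A y)}`, and it sends such a subspace to `A`. -/
def chart (e : Frame k m) : PartialEquiv (Gr ℝ k m) (Model k m) where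
  toFun := Function.invFun (graphPt e)
  invFun := graphPt e
  source := Set.range (graphPt e)
  target := Set.univ
  map_source' := fun _ _ => Set.mem_univ _
  map_target' := fun A _ => ⟨A, rfl⟩
  left_inv' := by
    rintro _ ⟨A, rfl⟩
    rw [Function.leftInverse_invFun (graphPt_injective e) A]
  right_inv' := fun A _ => Function.leftInverse_invFun (graphPt_injective e) A

theorem chart_graphPt (e : Frame k m) (A : Model k m) : chart e (graphPt e A) = A :=
  Function.leftInverse_invFun (graphPt_injective e) A

theorem graphPt_chart {e : Frame k m} {L : Gr ℝ k m} (h : L ∈ (chart e).source) :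
    graphPt e (chart e L) = L := (chart e).left_inv h

theorem exists_frame (L : Gr ℝ k m) : ∃ e : Frame k m, L ∈ (chart e).source := by
  obtain ⟨L, hL⟩ := L
  have hm : Module.finrank ℝ Lᗮ = m - k := by
    have := Submodule.finrank_add_finrank_orthogonal L
    rw [finrank_euclideanSpace_fin] at this
    omega
  let f : EuclideanSpace ℝ (Fin k) ≃ₗ[ℝ] L := LinearEquiv.ofFinrankEq _ _ (by simp [hL])
  let g : EuclideanSpace ℝ (Fin (m - k)) ≃ₗ[ℝ] Lᗮ :=
    LinearEquiv.ofFinrankEq _ _ (by simp [hm])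
  let e : Frame k m := ((f.prodCongr g).trans
    (Submodule.prodEquivOfIsCompl L Lᗮ
      L.isCompl_orthogonal)).toContinuousLinearEquiv
  refine ⟨e, 0, ?_⟩
  have he : ∀ y, e (y, 0) = (f y : EuclideanSpace ℝ (Fin m)) := fun y => by
    simp [e, Submodule.coe_prodEquivOfIsCompl']
  apply Subtype.ext
  ext x
  rw [mem_graphPt_iff_exists]
  constructor
  · rintro ⟨y, rfl⟩
    change e (y, 0) ∈ L
    rw [he]
    exact (f y).2
  · intro hx
    refine ⟨f.symm ⟨x, hx⟩, ?_⟩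
    change e (_, 0) = x
    rw [he]
    simp

/-- Linear coordinates adapted to `L`. -/
def frameAt (L : Gr ℝ k m) : Frame k m := (exists_frame L).choose

theorem frameAt_spec (L : Gr ℝ k m) : L ∈ (chart (frameAt L)).source :=
  (exists_frame L).choose_spec

/-- In coordinates `e'`, the first block of the parametrisation `y ↦ e (y, A y)`. -/
def transFst (e e' : Frame k m) (A : Model k m) :
    EuclideanSpace ℝ (Fin k) →L[ℝ] EuclideanSpace ℝ (Fin k) :=
  ContinuousLinearMap.fst ℝ (EuclideanSpace ℝ (Fin k)) (EuclideanSpace ℝ (Fin (m - k))) ∘L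
    e'.symm.toContinuousLinearMap ∘L graphMap e A

/-- In coordinates `e'`, the second block of the parametrisation `y ↦ e (y, A y)`. -/
def transSnd (e e' : Frame k m) (A : Model k m) : Model k m :=
  ContinuousLinearMap.snd ℝ (EuclideanSpace ℝ (Fin k)) (EuclideanSpace ℝ (Fin (m - k))) ∘L
    e'.symm.toContinuousLinearMap ∘L graphMap e A

theorem transFst_apply (e e' : Frame k m) (A : Model k m) (y : EuclideanSpace ℝ (Fin k)) :
    transFst e e' A y = (e'.symm (e (y, A y))).1 := rfl

theorem transSnd_apply (e e' : Frame k m) (A : Model k m) (y : EuclideanSpace ℝ (Fin k)) :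
    transSnd e e' A y = (e'.symm (e (y, A y))).2 := rfl

theorem contDiff_graphMap (e : Frame k m) : ContDiff ℝ ∞ (graphMap (k := k) (m := m) e) := by
  have h : graphMap (k := k) (m := m) e = fun A =>
      e.toContinuousLinearMap ∘L (ContinuousLinearMap.inl ℝ (EuclideanSpace ℝ (Fin k)) (EuclideanSpace ℝ (Fin (m - k)))) +
      e.toContinuousLinearMap ∘L (ContinuousLinearMap.inr ℝ (EuclideanSpace ℝ (Fin k)) (EuclideanSpace ℝ (Fin (m - k))) ∘L A) := by
    funext A
    ext1 y
    simp [← map_add]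
  rw [h]
  fun_prop

theorem contDiff_transFst (e e' : Frame k m) : ContDiff ℝ ∞ (transFst e e') := by
  unfold transFst
  have := contDiff_graphMap e
  fun_prop

theorem contDiff_transSnd (e e' : Frame k m) : ContDiff ℝ ∞ (transSnd e e') := by
  unfold transSnd
  have := contDiff_graphMap e
  fun_prop

theorem transSnd_eq {e e' : Frame k m} {A B : Model k m} (h : graphPt e A = graphPt e' B) :
    transSnd e e' A = B ∘L transFst e e' A := by
  ext1 y
  have h1 := apply_mem_graphPt e A y
  rw [h, mem_graphPt] at h1
  exact h1

theorem graphPt_mem_iff (e e' : Frame k m) (A : Model k m) :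
    graphPt e A ∈ (chart e').source ↔ IsUnit (transFst e e' A) := by
  constructor
  · rintro ⟨B, hB⟩
    have hs := transSnd_eq hB.symm
    have hinj : Function.Injective (transFst e e' A) := by
      rw [injective_iff_map_eq_zero]
      intro y hy
      have h2 : (e'.symm (e (y, A y))).2 = 0 := by
        rw [← transSnd_apply, hs]
        simp [hy]
      have h3 : e'.symm (e (y, A y)) = 0 := Prod.ext hy h2
      have h4 : ((y, A y) : EuclideanSpace ℝ (Fin k) × EuclideanSpace ℝ (Fin (m - k))) = 0 := by
        simpa using h3
      exact congrArg Prod.fst h4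
    let E := (LinearEquiv.ofInjectiveEndo (transFst e e' A).toLinearMap
      hinj).toContinuousLinearEquiv
    have : transFst e e' A = (E : _ →L[ℝ] _) := by
      ext1 y
      rfl
    rw [this]
    exact ((ContinuousLinearEquiv.unitsEquiv ℝ _).symm E).isUnit
  · rintro ⟨u, hu⟩
    refine ⟨transSnd e e' A ∘L (↑u⁻¹ : EuclideanSpace ℝ (Fin k) →L[ℝ] EuclideanSpace ℝ (Fin k)), ?_⟩
    have h1 : ∀ y, transFst e e' A ((↑u⁻¹ : EuclideanSpace ℝ (Fin k) →L[ℝ] EuclideanSpace ℝ (Fin k)) y) = y := fun y => by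
      rw [← hu]
      exact DFunLike.congr_fun u.mul_inv y
    have h2 : ∀ y, (↑u⁻¹ : EuclideanSpace ℝ (Fin k) →L[ℝ] EuclideanSpace ℝ (Fin k)) (transFst e e' A y) = y := fun y => by
      rw [← hu]
      exact DFunLike.congr_fun u.inv_mul y
    apply Subtype.ext
    ext x
    rw [mem_graphPt, mem_graphPt_iff_exists]
    constructor
    · intro h
      refine ⟨(↑u⁻¹ : EuclideanSpace ℝ (Fin k) →L[ℝ] EuclideanSpace ℝ (Fin k)) (e'.symm x).1, ?_⟩
      apply e'.symm.injective
      apply Prod.ext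
      · exact h1 _
      · rw [h]
        rfl
    · rintro ⟨y, rfl⟩
      change transSnd e e' A y = transSnd e e' A ((↑u⁻¹ : EuclideanSpace ℝ (Fin k) →L[ℝ] EuclideanSpace ℝ (Fin k)) (transFst e e' A y))
      rw [h2]

theorem trans_source (e e' : Frame k m) :
    ((chart e).symm.trans (chart e')).source = {A | IsUnit (transFst e e' A)} := by
  ext A
  simp only [PartialEquiv.trans_source, PartialEquiv.symm_source, Set.mem_inter_iff,
    Set.mem_preimage, Set.mem_ofPred_eq]
  rw [← graphPt_mem_iff]
  exact ⟨fun h => h.2, fun h => ⟨Set.mem_univ _, h⟩⟩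

theorem isOpen_trans_source (e e' : Frame k m) :
    IsOpen ((chart e).symm.trans (chart e')).source := by
  rw [trans_source]
  exact Units.isOpen.preimage (contDiff_transFst e e').continuous

theorem contDiffOn_trans (e e' : Frame k m) :
    ContDiffOn ℝ ∞ ((chart e).symm.trans (chart e')) ((chart e).symm.trans (chart e')).source := by
  have h : ContDiffOn ℝ ∞
      (fun A => transSnd e e' A ∘L Ring.inverse (transFst e e' A))
      ((chart e).symm.trans (chart e')).source := by
    rw [trans_source]
    rintro A ⟨u, hu⟩
    apply ContDiffAt.contDiffWithinAt
    have h0 : ContDiffAt ℝ ∞ Ring.inverse (transFst e e' A) := by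
      rw [← hu]
      exact contDiffAt_ringInverse ℝ u
    have h1 := h0.comp A (contDiff_transFst e e').contDiffAt
    exact (contDiff_transSnd e e').contDiffAt.clm_comp h1
  refine h.congr ?_
  intro A hA
  have hA' := hA
  rw [trans_source] at hA
  obtain ⟨B, hB⟩ := (graphPt_mem_iff e e' A).2 hA
  have hs := transSnd_eq hB.symm
  change chart e' (graphPt e A) = _
  rw [← hB, chart_graphPt, hs]
  obtain ⟨u, hu⟩ := hA
  rw [← hu, Ring.inverse_unit]
  ext1 y
  have : (u : EuclideanSpace ℝ (Fin k) →L[ℝ] EuclideanSpace ℝ (Fin k)) ((↑u⁻¹ : EuclideanSpace ℝ (Fin k) →L[ℝ] EuclideanSpace ℝ (Fin k)) y) = y := DFunLike.congr_fun u.mul_inv y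
  simp [this]

/-- The atlas of affine charts. -/
def core (k m : ℕ) : ChartedSpaceCore (Model k m) (Gr ℝ k m) where
  atlas := Set.range chart
  chartAt L := chart (frameAt L)
  mem_chart_source L := frameAt_spec L
  chart_mem_atlas L := ⟨_, rfl⟩
  open_source := by
    rintro _ _ ⟨e, rfl⟩ ⟨e', rfl⟩
    exact isOpen_trans_source e e'
  continuousOn_toFun := by
    rintro _ _ ⟨e, rfl⟩ ⟨e', rfl⟩
    exact (contDiffOn_trans e e').continuousOn

instance : TopologicalSpace (Gr ℝ k m) := (core k m).toTopologicalSpace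

instance : ChartedSpace (Model k m) (Gr ℝ k m) := (core k m).toChartedSpace

instance : IsManifold 𝓘(ℝ, Model k m) ∞ (Gr ℝ k m) := by
  apply isManifold_of_contDiffOn
  intro e e' he he'
  have key : ∀ f ∈ atlas (Model k m) (Gr ℝ k m),
      ∃ g : Frame k m, f.toPartialEquiv = chart g := by
    intro f hf
    change f ∈ ⋃ (e : PartialEquiv _ _) (he : e ∈ (core k m).atlas),
      {(core k m).openPartialHomeomorph e he} at hf
    simp only [Set.mem_iUnion, Set.mem_singleton_iff] at hf
    obtain ⟨_, ⟨g, rfl⟩, rfl⟩ := hf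
    exact ⟨g, rfl⟩
  obtain ⟨g, hg⟩ := key e he
  obtain ⟨g', hg'⟩ := key e' he'
  have h := contDiffOn_trans g g'
  rw [← hg, ← hg'] at h
  simpa using h

/-! ### The tautological bundle and its dual -/

/-- The fibre at `L` of the tautological bundle over `Gr_ℝ(k, m)` is `L` itself, with the norm
inherited from `ℝ^m`. -/
def Taut {k m : ℕ} (L : Gr ℝ k m) : Type := L.1

instance (L : Gr ℝ k m) : NormedAddCommGroup (Taut L) :=
  inferInstanceAs (NormedAddCommGroup L.1)

instance (L : Gr ℝ k m) : NormedSpace ℝ (Taut L) :=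
  inferInstanceAs (NormedSpace ℝ L.1)

instance (L : Gr ℝ k m) : FiniteDimensional ℝ (Taut L) :=
  inferInstanceAs (FiniteDimensional ℝ L.1)

theorem isOpen_chart_source (e : Frame k m) : IsOpen (chart (k := k) (m := m) e).source :=
  (core k m).open_source' ⟨e, rfl⟩

theorem continuousOn_chart (e : Frame k m) : ContinuousOn (chart e) (chart e).source :=
  ((core k m).openPartialHomeomorph (chart e) ⟨e, rfl⟩).continuousOn

theorem contMDiffOn_chart (e : Frame k m) :
    ContMDiffOn 𝓘(ℝ, Model k m) 𝓘(ℝ, Model k m) ∞ (chart e) (chart e).source := by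
  have h : (core k m).openPartialHomeomorph (chart e) ⟨e, rfl⟩ ∈ atlas (Model k m) (Gr ℝ k m) := by
    change _ ∈ ⋃ (e : PartialEquiv _ _) (he : e ∈ (core k m).atlas),
      {(core k m).openPartialHomeomorph e he}
    simp only [Set.mem_iUnion, Set.mem_singleton_iff]
    exact ⟨chart e, ⟨e, rfl⟩, rfl⟩
  exact contMDiffOn_of_mem_maximalAtlas (IsManifold.subset_maximalAtlas h)

/-- The linear isomorphism `ℝ^k → L`, `y ↦ e (y, A y)`, for `L` the graph of `A` in the linear
coordinates `e`. -/
def parFiber {e : Frame k m} {L : Gr ℝ k m} (h : L ∈ (chart e).source) :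
    EuclideanSpace ℝ (Fin k) ≃ₗ[ℝ] Taut L where
  toFun y := ⟨e (y, chart e L y), by
    have := apply_mem_graphPt e (chart e L) y
    rwa [graphPt_chart h] at this⟩
  map_add' y z := Subtype.ext (by
    change e (y + z, chart e L (y + z)) = e (y, chart e L y) + e (z, chart e L z)
    rw [← map_add e, map_add (chart e L)]
    rfl)
  map_smul' a y := Subtype.ext (by
    change e (a • y, chart e L (a • y)) = a • e (y, chart e L y)
    rw [← map_smul e, map_smul (chart e L)]
    rfl)
  invFun x := (e.symm x.1).1
  left_inv y := by
    change (e.symm (e (y, chart e L y))).1 = y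
    simp
  right_inv x := Subtype.ext (by
    change e ((e.symm x.1).1, chart e L (e.symm x.1).1) = x.1
    have hx : x.1 ∈ (graphPt e (chart e L)).1 := by
      rw [graphPt_chart h]
      exact x.2
    rw [mem_graphPt] at hx
    rw [← hx]
    simp)

open Classical in
/-- The local trivialisation of the tautological bundle over the domain of the chart attached to
`e`: the vector `e (y, A y)` of the graph of `A` is sent to `y`. -/
def tautTriv (e : Frame k m) :
    Bundle.Pretrivialization (EuclideanSpace ℝ (Fin k))
      (Bundle.TotalSpace.proj (F := EuclideanSpace ℝ (Fin k)) (E := Taut (k := k) (m := m))) where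
  toFun p := (p.1, (e.symm p.2.1).1)
  invFun q := ⟨q.1, if h : q.1 ∈ (chart e).source then parFiber h q.2 else 0⟩
  source := Bundle.TotalSpace.proj ⁻¹' (chart e).source
  target := (chart e).source ×ˢ Set.univ
  map_source' := fun p hp => ⟨hp, Set.mem_univ _⟩
  map_target' := fun q hq => hq.1
  left_inv' := by
    rintro ⟨L, x⟩ hL
    have hL' : L ∈ (chart e).source := hL
    simp only [hL', dite_true]
    congr 1
    exact (parFiber hL').right_inv x
  right_inv' := by
    rintro ⟨L, y⟩ ⟨hL, -⟩
    have hL' : L ∈ (chart e).source := hL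
    simp only [hL', dite_true]
    congr 1
    exact (parFiber hL').left_inv y
  open_target := (isOpen_chart_source e).prod isOpen_univ
  baseSet := (chart e).source
  open_baseSet := isOpen_chart_source e
  source_eq := rfl
  target_eq := rfl
  proj_toFun := fun _ _ => rfl

theorem tautTriv_symm {e : Frame k m} {L : Gr ℝ k m} (h : L ∈ (chart e).source)
    (y : EuclideanSpace ℝ (Fin k)) : (tautTriv e).symm L y = parFiber h y := by
  have h1 : (tautTriv e) ⟨L, parFiber h y⟩ = (L, y) :=
    Prod.ext rfl ((parFiber h).left_inv y)
  have h2 := (tautTriv e).symm_apply_apply_mk (b := L) h (parFiber h y)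
  rw [h1] at h2
  exact h2

theorem tautTriv_coordChange {e e' : Frame k m} {L : Gr ℝ k m}
    (h : L ∈ (tautTriv e).baseSet ∩ (tautTriv e').baseSet) (y : EuclideanSpace ℝ (Fin k)) :
    transFst e e' (chart e L) y = (tautTriv e' ⟨L, (tautTriv e).symm L y⟩).2 := by
  rw [tautTriv_symm h.1]
  rfl

/-- The tautological bundle over the real Grassmannian, through its local trivialisations. -/
def tautPrebundle (k m : ℕ) :
    VectorPrebundle ℝ (EuclideanSpace ℝ (Fin k)) (Taut (k := k) (m := m)) where
  pretrivializationAtlas := Set.range tautTriv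
  pretrivialization_linear' := by
    rintro _ ⟨e, rfl⟩
    refine ⟨fun L hL => ?_⟩
    exact (parFiber (e := e) hL).symm.toLinearMap.isLinear
  pretrivializationAt L := tautTriv (frameAt L)
  mem_base_pretrivializationAt L := frameAt_spec L
  pretrivialization_mem_atlas L := ⟨_, rfl⟩
  exists_coordChange := by
    rintro _ ⟨e, rfl⟩ _ ⟨e', rfl⟩
    refine ⟨fun L => transFst e e' (chart e L), ?_, fun L hL y => tautTriv_coordChange hL y⟩
    exact (contDiff_transFst e e').continuous.comp_continuousOn
      ((continuousOn_chart e).mono Set.inter_subset_left)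
  totalSpaceMk_isInducing L := by
    have h := (parFiber (frameAt_spec L)).toContinuousLinearEquiv.symm.toHomeomorph.isInducing
    exact (Topology.isInducing_const_prod (x := L)).2 h

instance : (tautPrebundle k m).IsContMDiff 𝓘(ℝ, Model k m) ∞ where
  exists_contMDiffCoordChange := by
    rintro _ ⟨e, rfl⟩ _ ⟨e', rfl⟩
    refine ⟨fun L => transFst e e' (chart e L), ?_, fun L hL y => tautTriv_coordChange hL y⟩
    exact (contDiff_transFst e e').contMDiff.comp_contMDiffOn
      ((contMDiffOn_chart e).mono Set.inter_subset_left)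

instance : TopologicalSpace
    (Bundle.TotalSpace (EuclideanSpace ℝ (Fin k)) (Taut (k := k) (m := m))) :=
  (tautPrebundle k m).totalSpaceTopology

instance : FiberBundle (EuclideanSpace ℝ (Fin k)) (Taut (k := k) (m := m)) :=
  (tautPrebundle k m).toFiberBundle

instance : VectorBundle ℝ (EuclideanSpace ℝ (Fin k)) (Taut (k := k) (m := m)) :=
  (tautPrebundle k m).toVectorBundle

instance : ContMDiffVectorBundle ∞ (EuclideanSpace ℝ (Fin k)) (Taut (k := k) (m := m))
    𝓘(ℝ, Model k m) :=
  (tautPrebundle k m).contMDiffVectorBundle 𝓘(ℝ, Model k m)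

/-- The fibre at `L` of the dual tautological bundle `τ*` over `Gr_ℝ(k, m)`: the linear functionals
on `L`. -/
abbrev DualTaut {k m : ℕ} (L : Gr ℝ k m) : Type :=
  Taut L →L[ℝ] Bundle.Trivial (Gr ℝ k m) ℝ L

/-- The total space of the dual tautological bundle over `Gr_ℝ(k, m)`, as a smooth vector bundle:
Mathlib's bundle `Hom(τ, ℝ)`. -/
abbrev DualTautTotal (k m : ℕ) : Type :=
  Bundle.TotalSpace (EuclideanSpace ℝ (Fin k) →L[ℝ] ℝ) (DualTaut (k := k) (m := m))

/-- The model with corners of the total space of the dual tautological bundle. -/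
abbrev dualTautModel (k m : ℕ) :=
  𝓘(ℝ, Model k m).prod 𝓘(ℝ, EuclideanSpace ℝ (Fin k) →L[ℝ] ℝ)

/-- The total space of the sphere bundle `S^{k-1}(τ*)` of the dual tautological bundle over
`Gr_ℝ(k, m)`: the linear functionals of (operator) norm one on the `k`-dimensional subspaces of
the Euclidean space `ℝ^m`. -/
def dualSphereBundle (k m : ℕ) : Set (DualTautTotal k m) :=
  {p | ‖(p.2 : Taut p.1 →L[ℝ] ℝ)‖ = 1}

/-! ### Moment maps and real level sets -/

section MomentMap

variable {𝕜 : Type} [RCLike 𝕜]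

/-- The Plücker coordinate `w_I` of the frame `b`, for `I` a strictly increasing `k`-tuple of
indices. -/
def plucker (b : Fin k → EuclideanSpace 𝕜 (Fin m)) (I : Fin k ↪o Fin m) : 𝕜 :=
  Matrix.det (Matrix.of fun a j => b a (I j))

/-- Some basis of `L`, from which homogeneous Plücker coordinates of `L` are computed. -/
def frame (L : Gr 𝕜 k m) (a : Fin k) : EuclideanSpace 𝕜 (Fin m) :=
  (Module.finBasisOfFinrankEq 𝕜 L.1 L.2 a : L.1)

open Classical in
/-- The moment map `F(μ_i)`: the sum of `|w_I|²` over the index tuples `I` containing `i`, divided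
by the sum of all `|w_I|²`. Changing the basis multiplies all `w_I` by a common nonzero scalar, so
the value depends only on `L`. -/
def momentMap (i : Fin m) (L : Gr 𝕜 k m) : ℝ :=
  (∑ I : Fin k ↪o Fin m, if i ∈ Set.range I then ‖plucker L.frame I‖ ^ 2 else 0) /
    ∑ I : Fin k ↪o Fin m, ‖plucker L.frame I‖ ^ 2

end MomentMap

/-- The coordinatewise inclusion `ℝ^m → ℂ^m`. -/
def toComplex (m : ℕ) : EuclideanSpace ℝ (Fin m) →ₗ[ℝ] EuclideanSpace ℂ (Fin m) where
  toFun x := WithLp.toLp 2 fun i => (x i : ℂ)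
  map_add' x y := by ext i; simp
  map_smul' a x := by ext i; simp

theorem linearIndependent_toComplex {b : Fin k → EuclideanSpace ℝ (Fin m)}
    (hb : LinearIndependent ℝ b) : LinearIndependent ℂ (fun a => toComplex m (b a)) := by
  rw [Fintype.linearIndependent_iff] at hb ⊢
  intro g hg
  have hcoord : ∀ i, ∑ a, g a * (b a i : ℂ) = 0 := fun i => by
    have := congrArg (fun v : EuclideanSpace ℂ (Fin m) => v i) hg
    simpa [toComplex] using this
  have hre : ∀ a, (g a).re = 0 := by
    apply hb
    ext i
    have := congrArg Complex.re (hcoord i)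
    simpa using this
  have him : ∀ a, (g a).im = 0 := by
    apply hb
    ext i
    have := congrArg Complex.im (hcoord i)
    simpa using this
  exact fun a => Complex.ext (hre a) (him a)

/-- The inclusion `Gr_ℝ(k, m) ⊂ Gr_ℂ(k, m)`, sending `L` to its complexification `L + iL`. -/
def complexify (L : Gr ℝ k m) : Gr ℂ k m :=
  ⟨Submodule.span ℂ (toComplex m '' (L.1 : Set (EuclideanSpace ℝ (Fin m)))), by
    have hli : LinearIndependent ℝ L.frame :=
      (Module.finBasisOfFinrankEq ℝ L.1 L.2).linearIndependent.map' L.1.subtype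
        (Submodule.ker_subtype _)
    have hspan : Submodule.span ℝ (Set.range L.frame) = L.1 := by
      have h := congrArg (Submodule.map L.1.subtype) (Module.finBasisOfFinrankEq ℝ L.1 L.2).span_eq
      rw [Submodule.map_span, ← Set.range_comp, Submodule.map_top, Submodule.range_subtype] at h
      exact h
    have key : Submodule.span ℂ (toComplex m '' (L.1 : Set (EuclideanSpace ℝ (Fin m)))) =
        Submodule.span ℂ (Set.range fun a => toComplex m (L.frame a)) := by
      apply le_antisymm
      · rw [Submodule.span_le]
        have hle : L.1 ≤ ((Submodule.span ℂ (Set.range fun a =>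
            toComplex m (L.frame a))).restrictScalars ℝ).comap (toComplex m) := by
          rw [← hspan, Submodule.span_le]
          rintro _ ⟨a, rfl⟩
          exact Submodule.subset_span ⟨a, rfl⟩
        rintro _ ⟨x, hx, rfl⟩
        exact hle hx
      · apply Submodule.span_mono
        rintro _ ⟨a, rfl⟩
        exact ⟨_, Subtype.property _, rfl⟩
    rw [key, finrank_span_eq_card (linearIndependent_toComplex hli)]
    simp⟩

/-- The level set `N(c) = {F(μ_n) = c}` in the complex Grassmannian `Gr(k, n+1)`. The coordinates
of `ℂ^{n+1}` are `Z_0, ..., Z_n`, and `μ_n` belongs to the last one. -/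
def levelSet (k n : ℕ) (c : ℝ) : Set (Gr ℂ k (n + 1)) :=
  {L | L.momentMap (Fin.last n) = c}

/-- The real level set `S_ℝ(c) = N(c) ∩ Gr_ℝ(k, n+1)`, as a subset of `Gr_ℝ(k, n+1)`. -/
def realLevelSet (k n : ℕ) (c : ℝ) : Set (Gr ℝ k (n + 1)) :=
  complexify ⁻¹' levelSet k n c

/-- The basis vector `v_n` of `ℝ^{n+1}`. -/
def lastVec (n : ℕ) : EuclideanSpace ℝ (Fin (n + 1)) := EuclideanSpace.single (Fin.last n) 1

/-- The isometric identification of `ℝ^n` with `⟨v_n⟩^⊥ ⊂ ℝ^{n+1}`. -/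
def incl (n : ℕ) : EuclideanSpace ℝ (Fin n) →ₗ[ℝ] EuclideanSpace ℝ (Fin (n + 1)) where
  toFun x := WithLp.toLp 2 (Fin.snoc (α := fun _ => ℝ) (fun i => x i) 0)
  map_add' x y := by
    ext i
    refine Fin.lastCases ?_ (fun j => ?_) i <;> simp
  map_smul' a x := by
    ext i
    refine Fin.lastCases ?_ (fun j => ?_) i <;> simp

/-- The angle between a vector `v` and a subspace `L`, that is, the angle between `v` and its
orthogonal projection to `L` (a right angle if this projection is zero). -/
def angleTo (v : EuclideanSpace ℝ (Fin m)) (L : Gr ℝ k m) : ℝ :=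
  InnerProductGeometry.angle v (L.1.starProjection v)

end Gr

/-! ### Hypersurfaces and diffeomorphisms between subsets of manifolds -/

section Subsets

variable {E E' H H' M N : Type*} [NormedAddCommGroup E] [NormedSpace ℝ E] [TopologicalSpace H]
  [NormedAddCommGroup E'] [NormedSpace ℝ E'] [TopologicalSpace H']
  [TopologicalSpace M] [ChartedSpace H M] [TopologicalSpace N] [ChartedSpace H' N]

/-- `S` is a smooth embedded hypersurface (submanifold of codimension one) of `M`: near each of
its points it is the zero set of a smooth function with nonzero differential at that point. -/
def IsSmoothHypersurface (I : ModelWithCorners ℝ E H) (S : Set M) : Prop :=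
  ∀ x ∈ S, ∃ U : Set M, IsOpen U ∧ x ∈ U ∧ ∃ h : M → ℝ,
    ContMDiffOn I 𝓘(ℝ, ℝ) ∞ h U ∧ mfderiv I 𝓘(ℝ, ℝ) h x ≠ 0 ∧ S ∩ U = {y ∈ U | h y = 0}

/-- A map between subsets `S ⊆ M` and `T ⊆ N` of manifolds is smooth if, near each point of `S`,
it is the restriction of a smooth map from an open subset of `M` to `N`. -/
def IsSmoothBetween (I : ModelWithCorners ℝ E H) (J : ModelWithCorners ℝ E' H')
    {S : Set M} {T : Set N} (f : S → T) : Prop :=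
  ∀ x : S, ∃ U : Set M, IsOpen U ∧ (x : M) ∈ U ∧ ∃ g : M → N,
    ContMDiffOn I J ∞ g U ∧ ∀ y : S, (y : M) ∈ U → g y = f y

/-- A bijection between subsets of manifolds that is smooth in both directions. -/
def IsDiffeoBetween (I : ModelWithCorners ℝ E H) (J : ModelWithCorners ℝ E' H')
    {S : Set M} {T : Set N} (f : S ≃ T) : Prop :=
  IsSmoothBetween I J f ∧ IsSmoothBetween J I f.symm

end Subsets

end

noncomputable section

/-! For a real `L` with an orthonormal basis, Cauchy–Binet says that the squared Plücker coordinates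
add up to 1. Let `u` be the vector of last coordinates of the basis. Replacing the last column by
zero changes the Gram matrix from `1` to `1 - u uᵀ`, so the coordinates whose index avoids `n`
contribute `1 - |u|²`. Hence `F(μ_n)(L) = |u|² = ‖P_L v_n‖²`, the squared cosine of the angle
between `v_n` and `L` (`momentMap_complexify_eq_norm_sq`). This is the angle criterion.

If this value is less than 1, then `v_n ∉ L`, so `L` projects injectively to `ℝ^n`. It is therefore
the graph `{x + r φ(x) v_n : x ∈ L₀}` of a unique functional `φ` on its projection `L₀`, for any
fixed `r ≠ 0`. Riesz representation gives the value `(r‖φ‖)² / (1 + (r‖φ‖)²)`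
(`momentMap_complexify_graphOver`); with `r² = c/(1-c)` it equals `c` exactly when `‖φ‖ = 1`. So
`graphOver r` maps the sphere bundle bijectively onto the level set.

In suitable charts `graphOver r` is an invertible linear map, hence smooth with smooth local
inverses. The level function has nonzero derivative along the rays `s ↦ s φ`, which makes both sets
hypersurfaces. The count of two reflects the two unit functionals `±φ` on `L₀` with kernel `M`. -/

/-! ### The Cauchy–Binet formula. -/

/-- Every injective map out of `Fin k` is, uniquely, a strictly increasing map after a
permutation. -/
theorem bijective_orderEmbedding_comp_perm {ι : Type*} [LinearOrder ι] (k : ℕ) :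
    Function.Bijective fun p : (Fin k ↪o ι) × Equiv.Perm (Fin k) =>
      p.2.toEmbedding.trans p.1.toEmbedding := by
  constructor
  · rintro ⟨I, σ⟩ ⟨J, τ⟩ h
    have h1 : ∀ a, I (σ a) = J (τ a) := fun a => DFunLike.congr_fun h a
    have hIJ : I = J := by
      apply OrderEmbedding.range_inj.1
      rw [← σ.surjective.range_comp I, ← τ.surjective.range_comp J]
      exact congrArg Set.range (funext h1)
    subst hIJ
    exact Prod.ext rfl (Equiv.ext fun a => I.injective (h1 a))
  · intro f
    -- Sorting the values of `f` gives the increasing map; the inverse of the sorting permutation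
    -- restores the order of `f`.
    have hs : StrictMono (f ∘ Tuple.sort f) :=
      (Tuple.monotone_sort f).strictMono_of_injective (f.injective.comp (Tuple.sort f).injective)
    refine ⟨(OrderEmbedding.ofStrictMono _ hs, (Tuple.sort f)⁻¹), ?_⟩
    ext a
    exact congrArg f ((Tuple.sort f).apply_symm_apply a)

/-- The **Cauchy–Binet formula**. -/
theorem Matrix.det_mul_eq_sum_orderEmbedding {R ι : Type*} [CommRing R] [Fintype ι]
    [LinearOrder ι] {k : ℕ} (A : Matrix (Fin k) ι R) (B : Matrix ι (Fin k) R) :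
    (A * B).det = ∑ I : Fin k ↪o ι, (A.submatrix id I).det * (B.submatrix I id).det := by
  classical
  -- Each row of `A * B` is a combination of rows of `B`; expand by multilinearity in the rows.
  have h1 : (A * B).det = ∑ f : Fin k → ι, (∏ a, A a (f a)) * (B.submatrix f id).det := by
    have : A * B = fun a => ∑ j, A a j • B j := by
      ext a b
      simp [Matrix.mul_apply, Finset.sum_apply]
    rw [this]
    change Matrix.detRowAlternating.toMultilinearMap (fun a => ∑ j, A a j • B j) = _
    rw [MultilinearMap.map_sum]
    refine Finset.sum_congr rfl fun f _ => ?_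
    rw [MultilinearMap.map_smul_univ]
    rfl
  -- A non-injective choice of rows repeats a row, so its determinant vanishes.
  have h2 : ∑ f : Fin k → ι, (∏ a, A a (f a)) * (B.submatrix f id).det =
      ∑ f : Fin k ↪ ι, (∏ a, A a (f a)) * (B.submatrix f id).det := by
    symm
    refine Finset.sum_of_injOn (fun f : Fin k ↪ ι => (f : Fin k → ι))
      DFunLike.coe_injective.injOn (by simp) ?_ (fun _ _ => rfl)
    intro f _ hf
    have hf' : ¬ Function.Injective f := fun h => hf ⟨⟨f, h⟩, by simp, rfl⟩
    rw [Function.not_injective_iff] at hf'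
    obtain ⟨a, b, hab, hne⟩ := hf'
    rw [Matrix.det_zero_of_row_eq hne (by ext; simp [hab]), mul_zero]
  rw [h1, h2, ← (bijective_orderEmbedding_comp_perm k).sum_comp, Fintype.sum_prod_type]
  refine Finset.sum_congr rfl fun I _ => ?_
  -- For fixed `I` the sum over permutations is the Leibniz expansion of the minor of `A`; the signs
  -- come from permuting the rows of the minor of `B`.
  rw [← Matrix.det_transpose (A.submatrix id I), Matrix.det_apply', Finset.sum_mul]
  refine Finset.sum_congr rfl fun σ _ => ?_
  have : B.submatrix (σ.toEmbedding.trans I.toEmbedding) id =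
      (B.submatrix I id).submatrix σ id := rfl
  rw [this, Matrix.det_permute]
  simp only [Function.Embedding.trans_apply, Equiv.coe_toEmbedding, RelEmbedding.coe_toEmbedding,
    Matrix.transpose_apply, Matrix.submatrix_apply, id_eq]
  ring

/-! ### The moment map on real subspaces. -/

namespace Gr

variable {k m n : ℕ}

theorem plucker_sum_smul {𝕜 : Type} [RCLike 𝕜] (b : Fin k → EuclideanSpace 𝕜 (Fin m))
    (C : Matrix (Fin k) (Fin k) 𝕜) (I : Fin k ↪o Fin m) :
    plucker (fun a => ∑ a', C a a' • b a') I = C.det * plucker b I := by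
  unfold plucker
  rw [← Matrix.det_mul]
  congr 1
  ext a j
  simp [Matrix.mul_apply]

open Classical in
/-- The share of the Plücker coordinates containing the index `i` in the sum of the squared
absolute values of all Plücker coordinates. -/
def pluckerShare {𝕜 : Type} [RCLike 𝕜] (i : Fin m) (b : Fin k → EuclideanSpace 𝕜 (Fin m)) : ℝ :=
  (∑ I : Fin k ↪o Fin m, if i ∈ Set.range I then ‖plucker b I‖ ^ 2 else 0) /
    ∑ I : Fin k ↪o Fin m, ‖plucker b I‖ ^ 2

/-- Numerator and denominator both scale by the squared absolute value of the determinant of the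
base change. This frees the moment map from the arbitrary basis `frame`. -/
theorem momentMap_eq_pluckerShare {𝕜 : Type} [RCLike 𝕜] (i : Fin m) (L : Gr 𝕜 k m)
    (b : Module.Basis (Fin k) 𝕜 L.1) :
    L.momentMap i = pluckerShare i fun a => (b a : EuclideanSpace 𝕜 (Fin m)) := by
  set f := Module.finBasisOfFinrankEq 𝕜 L.1 L.2
  set C : Matrix (Fin k) (Fin k) 𝕜 := (f.toMatrix b).transpose
  have hC : C.det ≠ 0 := by
    have : IsUnit (f.toMatrix b) := @isUnit_of_invertible _ _ _ (f.invertibleToMatrix b)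
    rw [Matrix.det_transpose]
    exact ((Matrix.isUnit_iff_isUnit_det _).1 this).ne_zero
  have hb : (fun a => (b a : EuclideanSpace 𝕜 (Fin m))) = fun a => ∑ a', C a a' • L.frame a' := by
    funext a
    have := congrArg (Subtype.val) (f.sum_toMatrix_smul_self b a)
    change (b a : EuclideanSpace 𝕜 (Fin m)) =
      ∑ a', f.toMatrix b a' a • (f a' : EuclideanSpace 𝕜 (Fin m))
    refine this.symm.trans ?_
    rw [AddSubmonoidClass.coe_finsetSum]
    rfl
  rw [hb]
  unfold momentMap pluckerShare
  simp only [plucker_sum_smul, norm_mul, mul_pow, ← mul_ite_zero, ← Finset.mul_sum]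
  rw [mul_div_mul_left]
  exact pow_ne_zero _ (norm_ne_zero_iff.2 hC)

theorem plucker_toComplex (b : Fin k → EuclideanSpace ℝ (Fin m)) (I : Fin k ↪o Fin m) :
    plucker (fun a => toComplex m (b a)) I = ((plucker b I : ℝ) : ℂ) := by
  unfold plucker
  rw [← Complex.ofRealHom_eq_coe, RingHom.map_det]
  rfl

/-- A real basis of `L` is also a complex basis of the complexification, with the same Plücker
coordinates. -/
theorem momentMap_complexify (i : Fin m) (L : Gr ℝ k m) (b : Module.Basis (Fin k) ℝ L.1) :
    (complexify L).momentMap i = pluckerShare i fun a => (b a : EuclideanSpace ℝ (Fin m)) := by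
  have hb : LinearIndependent ℝ fun a => (b a : EuclideanSpace ℝ (Fin m)) :=
    b.linearIndependent.map' L.1.subtype (Submodule.ker_subtype _)
  let w : Fin k → (complexify L).1 := fun a =>
    ⟨toComplex m (b a), Submodule.subset_span ⟨b a, (b a).2, rfl⟩⟩
  have hw : LinearIndependent ℂ w :=
    LinearIndependent.of_comp (complexify L).1.subtype (linearIndependent_toComplex hb)
  -- For `k = 0` the construction of a basis from an independent family of full size is not
  -- available, its index type being empty; there the share is 0 for every basis.
  cases k with
  | zero =>
    rw [momentMap_eq_pluckerShare i _ (Module.finBasisOfFinrankEq ℂ _ (complexify L).2)]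
    simp [pluckerShare, plucker]
  | succ k =>
    let B := basisOfLinearIndependentOfCardEqFinrank hw
      (by rw [(complexify L).2]; simp)
    rw [momentMap_eq_pluckerShare i _ B]
    have hB : (fun a => (B a : EuclideanSpace ℂ (Fin m))) = fun a => toComplex m (b a) := by
      funext a
      simp [B, w]
    rw [hB]
    simp [pluckerShare, plucker_toComplex]

/-- The squared Plücker coordinates of an orthonormal family sum up to one. -/
theorem sum_plucker_sq {b : Fin k → EuclideanSpace ℝ (Fin m)} (hb : Orthonormal ℝ b) :
    ∑ I : Fin k ↪o Fin m, plucker b I ^ 2 = 1 := by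
  have h := Matrix.det_mul_eq_sum_orderEmbedding (Matrix.of fun a j => b a j)
    (Matrix.of fun a j => b a j).transpose
  have h1 : (Matrix.of fun a j => b a j) * (Matrix.of fun a j => b a j).transpose = 1 := by
    ext a a'
    have := orthonormal_iff_ite.1 hb a' a
    rw [PiLp.inner_apply] at this
    simpa [Matrix.mul_apply, Matrix.one_apply, eq_comm] using this
  rw [h1, Matrix.det_one] at h
  rw [h]
  refine Finset.sum_congr rfl fun I _ => ?_
  rw [← Matrix.transpose_submatrix, Matrix.det_transpose, sq]
  rfl

-- Cauchy–Binet for the matrix `B` with column `i` set to zero: the minors through `i` vanish and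
-- the others are unchanged. The Gram matrix of `B` is a rank-one perturbation of the identity,
-- whose determinant is known.
open Classical in
theorem sum_plucker_sq_notMem {b : Fin k → EuclideanSpace ℝ (Fin m)} (hb : Orthonormal ℝ b)
    (i : Fin m) :
    ∑ I : Fin k ↪o Fin m, (if i ∈ Set.range I then 0 else plucker b I ^ 2) =
      1 - ∑ a, b a i ^ 2 := by
  set B : Matrix (Fin k) (Fin m) ℝ := Matrix.of fun a j => if j = i then 0 else b a j
  have h := Matrix.det_mul_eq_sum_orderEmbedding B B.transpose
  have h1 : B * B.transpose =
      1 + Matrix.replicateCol Unit (fun a => - b a i) *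
        Matrix.replicateRow Unit (fun a => b a i) := by
    ext a a'
    have := orthonormal_iff_ite.1 hb a' a
    rw [PiLp.inner_apply, ← Finset.add_sum_erase _ _ (Finset.mem_univ i)] at this
    simp only [Matrix.add_apply, Matrix.one_apply]
    rw [Matrix.mul_apply, ← Finset.add_sum_erase _ _ (Finset.mem_univ i)]
    have h2 : ∑ j ∈ Finset.univ.erase i, B a j * B.transpose j a' =
        ∑ j ∈ Finset.univ.erase i, inner ℝ (b a' j) (b a j) := by
      refine Finset.sum_congr rfl fun j hj => ?_
      simp [B, Finset.ne_of_mem_erase hj]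
    rw [h2]
    simp only [eq_comm (a := a')] at this
    rw [← this]
    simp [B, Matrix.mul_apply]
    ring
  rw [h1, Matrix.det_one_add_replicateCol_mul_replicateRow] at h
  have h3 : 1 - ∑ a, b a i ^ 2 = 1 + (fun a => b a i) ⬝ᵥ (fun a => - b a i) := by
    simp [dotProduct, sq, sub_eq_add_neg]
  rw [h3, h]
  refine Finset.sum_congr rfl fun I _ => ?_
  rw [← Matrix.transpose_submatrix, Matrix.det_transpose, ← sq]
  split_ifs with hi
  · obtain ⟨j, rfl⟩ := hi
    rw [Matrix.det_eq_zero_of_column_eq_zero j (by simp [B])]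
    simp
  · congr 1
    refine congrArg Matrix.det (Matrix.ext fun a j => ?_)
    have : I j ≠ i := fun h => hi ⟨j, h⟩
    simp [B, this]

theorem norm_starProjection_sq {E ι : Type*} [NormedAddCommGroup E] [InnerProductSpace ℝ E]
    [Fintype ι] (S : Submodule ℝ E) [FiniteDimensional ℝ S] (b : OrthonormalBasis ι ℝ S) (v : E) :
    ‖S.starProjection v‖ ^ 2 = ∑ a, inner ℝ (b a : E) v ^ 2 := by
  rw [Submodule.starProjection_apply, Submodule.norm_coe, ← b.sum_sq_norm_inner_right]
  refine Finset.sum_congr rfl fun a _ => ?_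
  rw [Submodule.inner_orthogonalProjectionOnto_eq_of_mem_left, Real.norm_eq_abs, sq_abs]

/-- The moment map of a real subspace is the squared length of the projection of the basis
vector. -/
theorem momentMap_complexify_eq_norm_sq (i : Fin m) (L : Gr ℝ k m) :
    (complexify L).momentMap i = ‖L.1.starProjection (EuclideanSpace.single i 1)‖ ^ 2 := by
  classical
  let b : OrthonormalBasis (Fin k) ℝ L.1 :=
    (stdOrthonormalBasis ℝ L.1).reindex (finCongr L.2)
  have hb : Orthonormal ℝ fun a => (b a : EuclideanSpace ℝ (Fin m)) :=
    b.orthonormal.comp_linearIsometry L.1.subtypeₗᵢ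
  rw [momentMap_complexify i L b.toBasis]
  simp only [OrthonormalBasis.coe_toBasis, pluckerShare, Real.norm_eq_abs, sq_abs]
  rw [sum_plucker_sq hb, div_one]
  have h1 := sum_plucker_sq hb
  have h2 := sum_plucker_sq_notMem hb i
  -- Split the total 1 into the tuples that contain `i` and those that do not; the second part is
  -- already computed.
  have h3 : ∀ I : Fin k ↪o Fin m,
      plucker (fun a => (b a : EuclideanSpace ℝ (Fin m))) I ^ 2 =
      (if i ∈ Set.range I then plucker (fun a => (b a : EuclideanSpace ℝ (Fin m))) I ^ 2 else 0) +
      (if i ∈ Set.range I then 0 else plucker (fun a => (b a : EuclideanSpace ℝ (Fin m))) I ^ 2) :=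
    fun I => by split_ifs <;> simp
  rw [Finset.sum_congr rfl fun I _ => h3 I, Finset.sum_add_distrib, h2] at h1
  have h4 : ‖L.1.starProjection (EuclideanSpace.single i 1)‖ ^ 2 =
      ∑ a, (b a : EuclideanSpace ℝ (Fin m)) i ^ 2 := by
    rw [norm_starProjection_sq L.1 b]
    simp [EuclideanSpace.inner_single_right]
  rw [h4]
  linarith

end Gr

/-! ### Subspaces of `ℝ^{n+1}` as graphs of functionals, angles, and the bijection with the sphere
bundle. -/

namespace Gr

variable {k m n : ℕ}

/-- The orthogonal projection `ℝ^{n+1} → ℝ^n` that forgets the last coordinate. -/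
def dropLast (n : ℕ) : EuclideanSpace ℝ (Fin (n + 1)) →ₗ[ℝ] EuclideanSpace ℝ (Fin n) where
  toFun y := WithLp.toLp 2 fun i => y i.castSucc
  map_add' x y := by ext i; simp
  map_smul' a x := by ext i; simp

@[simp] theorem incl_last (x : EuclideanSpace ℝ (Fin n)) : incl n x (Fin.last n) = 0 := by
  simp [incl]

@[simp] theorem incl_castSucc (x : EuclideanSpace ℝ (Fin n)) (i : Fin n) :
    incl n x i.castSucc = x i := by
  simp [incl]

@[simp] theorem lastVec_last : lastVec n (Fin.last n) = 1 := by simp [lastVec]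

@[simp] theorem lastVec_castSucc (i : Fin n) : lastVec n i.castSucc = 0 := by
  simp [lastVec, Fin.castSucc_ne_last]

@[simp] theorem dropLast_incl (x : EuclideanSpace ℝ (Fin n)) : dropLast n (incl n x) = x := by
  ext i
  simp [dropLast]

@[simp] theorem dropLast_lastVec : dropLast n (lastVec n) = 0 := by
  ext i
  simp [dropLast]

@[simp] theorem norm_lastVec : ‖lastVec n‖ = 1 := by simp [lastVec]

theorem incl_dropLast_add (y : EuclideanSpace ℝ (Fin (n + 1))) :
    incl n (dropLast n y) + y (Fin.last n) • lastVec n = y := by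
  ext i
  refine Fin.lastCases ?_ (fun j => ?_) i <;> simp [dropLast]

theorem inner_incl_incl (x y : EuclideanSpace ℝ (Fin n)) :
    inner ℝ (incl n x) (incl n y) = inner ℝ x y := by
  simp [PiLp.inner_apply, Fin.sum_univ_castSucc]

theorem inner_lastVec_right (y : EuclideanSpace ℝ (Fin (n + 1))) :
    inner ℝ y (lastVec n) = y (Fin.last n) := by
  simp [lastVec, EuclideanSpace.inner_single_right]

theorem inner_lastVec_left (y : EuclideanSpace ℝ (Fin (n + 1))) :
    inner ℝ (lastVec n) y = y (Fin.last n) := by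
  rw [real_inner_comm, inner_lastVec_right]

/-- If `a` represents `f` by Riesz, then `a + ‖f‖² v_n` lies in the graph, and dividing it by `1 +
‖f‖²` gives the orthogonal projection of `v_n`. -/
theorem norm_sq_starProjection_graph (S : Submodule ℝ (EuclideanSpace ℝ (Fin n)))
    (f : S →L[ℝ] ℝ) (T : Submodule ℝ (EuclideanSpace ℝ (Fin (n + 1))))
    (hT : ∀ y, y ∈ T ↔ ∃ x : S, incl n x + f x • lastVec n = y) :
    ‖T.starProjection (lastVec n)‖ ^ 2 = ‖f‖ ^ 2 / (1 + ‖f‖ ^ 2) := by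
  set a : S := (InnerProductSpace.toDual ℝ S).symm f with ha
  have hfa : ∀ x : S, f x = inner ℝ (a : EuclideanSpace ℝ (Fin n)) x := fun x => by
    rw [← Submodule.coe_inner, ha, InnerProductSpace.toDual_symm_apply]
  have hna : ‖a‖ = ‖f‖ := (InnerProductSpace.toDual ℝ S).symm.norm_map f
  have hf : f a = ‖f‖ ^ 2 := by
    rw [hfa, real_inner_self_eq_norm_sq, ← hna, Submodule.coe_norm]
  have hpos : (0 : ℝ) < 1 + ‖f‖ ^ 2 := by positivity
  have hP : T.starProjection (lastVec n) =
      (1 + ‖f‖ ^ 2)⁻¹ • (incl n a + f a • lastVec n) := by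
    apply Submodule.eq_starProjection_of_mem_of_inner_eq_zero
    · exact T.smul_mem _ ((hT _).2 ⟨a, rfl⟩)
    · intro y hy
      obtain ⟨x, rfl⟩ := (hT y).1 hy
      simp only [inner_sub_left, inner_smul_left, inner_add_left, inner_add_right,
        inner_smul_right, inner_incl_incl, inner_lastVec_right, inner_lastVec_left, ← hfa, hf,
        incl_last, lastVec_last, conj_trivial]
      field_simp
      ring
  -- For an orthogonal projection `‖P v‖² = ⟨P v, v⟩`, so only the last coordinate of the projection
  -- is needed.
  have h1 : ‖T.starProjection (lastVec n)‖ ^ 2 = inner ℝ (T.starProjection (lastVec n))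
      (lastVec n) := by
    rw [← real_inner_self_eq_norm_sq, Submodule.inner_starProjection_left_eq_right,
      Submodule.starProjection_eq_self_iff.2 (Submodule.starProjection_apply_mem _ _),
      ← Submodule.inner_starProjection_left_eq_right]
  rw [h1, hP, inner_lastVec_right]
  simp [hf]
  ring

/-- The linear map `x ↦ x + r φ(x) v_n` on `L₀ ⊂ ℝ^n`. -/
def overMap (r : ℝ) (L₀ : Gr ℝ k n) (φ : Taut L₀ →L[ℝ] ℝ) :
    L₀.1 →ₗ[ℝ] EuclideanSpace ℝ (Fin (n + 1)) :=
  incl n ∘ₗ L₀.1.subtype + (r • (show L₀.1 →L[ℝ] ℝ from φ).toLinearMap).smulRight (lastVec n)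

theorem overMap_apply (r : ℝ) (L₀ : Gr ℝ k n) (φ : Taut L₀ →L[ℝ] ℝ) (x : Taut L₀) :
    overMap r L₀ φ x = incl n x.1 + (r * φ x) • lastVec n := rfl

theorem dropLast_overMap (r : ℝ) (L₀ : Gr ℝ k n) (φ : Taut L₀ →L[ℝ] ℝ) (x : Taut L₀) :
    dropLast n (overMap r L₀ φ x) = x.1 := by
  simp [overMap_apply]

theorem overMap_injective (r : ℝ) (L₀ : Gr ℝ k n) (φ : Taut L₀ →L[ℝ] ℝ) :
    Function.Injective (overMap r L₀ φ) := fun x y h => by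
  exact Subtype.ext ((dropLast_overMap r L₀ φ x).symm.trans
    ((congrArg (dropLast n) h).trans (dropLast_overMap r L₀ φ y)))

/-- The graph `{x + r φ(x) v_n : x ∈ L₀}` of a functional on `L₀ ⊂ ℝ^n`. -/
def graphOver (r : ℝ) (p : DualTautTotal k n) : Gr ℝ k (n + 1) :=
  ⟨LinearMap.range (overMap r p.1 p.2), by
    rw [LinearMap.finrank_range_of_inj (overMap_injective r p.1 p.2)]
    exact p.1.2⟩

theorem mem_graphOver {r : ℝ} {L₀ : Gr ℝ k n} {φ : Taut L₀ →L[ℝ] ℝ}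
    {y : EuclideanSpace ℝ (Fin (n + 1))} :
    y ∈ (graphOver r ⟨L₀, φ⟩).1 ↔ ∃ x : Taut L₀, incl n x.1 + (r * φ x) • lastVec n = y :=
  LinearMap.mem_range

theorem graphOver_le (r : ℝ) (L₀ : Gr ℝ k n) (φ : Taut L₀ →L[ℝ] ℝ) :
    (graphOver r ⟨L₀, φ⟩).1 ≤ Submodule.span ℝ {lastVec n} ⊔ L₀.1.map (incl n) := by
  intro y hy
  obtain ⟨x, rfl⟩ := mem_graphOver.1 hy
  exact Submodule.add_mem _ (Submodule.mem_sup_right (Submodule.mem_map_of_mem x.2))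
    (Submodule.mem_sup_left (Submodule.smul_mem _ _ (Submodule.mem_span_singleton_self _)))

theorem incl_mem_graphOver {r : ℝ} (hr : r ≠ 0) {L₀ : Gr ℝ k n} {φ : Taut L₀ →L[ℝ] ℝ}
    (x : Taut L₀) : incl n x.1 ∈ (graphOver r ⟨L₀, φ⟩).1 ↔ φ x = 0 := by
  rw [mem_graphOver]
  constructor
  · rintro ⟨y, hy⟩
    have h1 := congrArg (dropLast n) hy
    have h2 := congrArg (fun z => z (Fin.last n)) hy
    simp at h1
    obtain rfl : y = x := Subtype.ext h1
    simpa [hr] using h2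
  · intro h
    exact ⟨x, by simp [h]⟩

theorem map_dropLast_graphOver (r : ℝ) (p : DualTautTotal k n) :
    (graphOver r p).1.map (dropLast n) = p.1.1 := by
  ext x
  constructor
  · rintro ⟨_, ⟨y, rfl⟩, rfl⟩
    exact (dropLast_overMap r p.1 p.2 y).symm ▸ y.2
  · intro hx
    exact ⟨_, ⟨⟨x, hx⟩, rfl⟩, dropLast_overMap r p.1 p.2 _⟩

/-- The graph determines `L₀` as its projection to `ℝ^n`, and `r φ(x)` as the last coordinate of its
point over `x`. -/
theorem graphOver_injective {r : ℝ} (hr : r ≠ 0) :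
    Function.Injective (graphOver (k := k) (n := n) r) := by
  rintro ⟨L₀, φ⟩ ⟨L₁, ψ⟩ h
  have h1 : L₀ = L₁ := by
    apply Subtype.ext
    have := congrArg (fun L => L.1.map (dropLast n)) h
    simpa only [map_dropLast_graphOver] using this
  subst h1
  congr 1
  refine ContinuousLinearMap.ext fun x => ?_
  have hx : incl n x.1 + (r * φ x) • lastVec n ∈ (graphOver r ⟨L₀, φ⟩).1 :=
    mem_graphOver.2 ⟨x, rfl⟩
  rw [h] at hx
  obtain ⟨y, hy⟩ := mem_graphOver.1 hx
  have h1 := congrArg (dropLast n) hy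
  have h2 := congrArg (fun z => z (Fin.last n)) hy
  simp at h1
  obtain rfl : y = x := Subtype.ext h1
  have h3 : ψ y = φ y := by simpa [hr] using h2
  exact h3.symm

/-- The kernel of `dropLast` is the line through `v_n`, so `dropLast` is injective on `L` when `v_n
∉ L`. The functional is the last coordinate, transported to the image of `L` and divided by `r`. -/
theorem exists_graphOver_eq {r : ℝ} (hr : r ≠ 0) {L : Gr ℝ k (n + 1)} (hL : lastVec n ∉ L.1) :
    ∃ p, graphOver r p = L := by
  set d : L.1 →ₗ[ℝ] EuclideanSpace ℝ (Fin n) := dropLast n ∘ₗ L.1.subtype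
  have hd : Function.Injective d := by
    rw [injective_iff_map_eq_zero]
    intro y hy
    have h1 := incl_dropLast_add (y : EuclideanSpace ℝ (Fin (n + 1)))
    have h2 : dropLast n y = 0 := hy
    rw [h2, map_zero, zero_add] at h1
    by_cases h0 : (y : EuclideanSpace ℝ (Fin (n + 1))) (Fin.last n) = 0
    · apply Subtype.ext
      rw [← h1, h0, zero_smul]
      rfl
    · refine absurd ?_ hL
      rw [← inv_smul_smul₀ h0 (lastVec n), h1]
      exact L.1.smul_mem _ y.2
  let E := LinearEquiv.ofInjective d hd
  let L₀ : Gr ℝ k n := ⟨LinearMap.range d, by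
    rw [LinearMap.finrank_range_of_inj hd]
    exact L.2⟩
  let f : L₀.1 →ₗ[ℝ] ℝ := r⁻¹ • (EuclideanSpace.proj (𝕜 := ℝ) (Fin.last n)).toLinearMap ∘ₗ
    L.1.subtype ∘ₗ E.symm.toLinearMap
  let φ : Taut L₀ →L[ℝ] ℝ :=
    LinearMap.toContinuousLinearMap (show Taut L₀ →ₗ[ℝ] ℝ from f)
  have key : ∀ y : L.1, incl n (E y : EuclideanSpace ℝ (Fin n)) + (r * f (E y)) • lastVec n = y := by
    intro y
    have h1 : f (E y) = r⁻¹ * (y : EuclideanSpace ℝ (Fin (n + 1))) (Fin.last n) := by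
      simp [f]
    rw [h1, mul_inv_cancel_left₀ hr]
    exact incl_dropLast_add _
  refine ⟨⟨L₀, φ⟩, Subtype.ext ?_⟩
  ext y
  rw [mem_graphOver]
  constructor
  · rintro ⟨x, rfl⟩
    obtain ⟨z, rfl⟩ := E.surjective x
    have : incl n (E z : EuclideanSpace ℝ (Fin n)) + (r * φ (E z)) • lastVec n = z := key z
    exact this ▸ z.2
  · intro hy
    exact ⟨E ⟨y, hy⟩, key ⟨y, hy⟩⟩

theorem mem_realLevelSet {c : ℝ} {L : Gr ℝ k (n + 1)} :
    L ∈ realLevelSet k n c ↔ ‖L.1.starProjection (lastVec n)‖ ^ 2 = c := by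
  rw [← show _ = ‖L.1.starProjection (lastVec n)‖ ^ 2 from
    momentMap_complexify_eq_norm_sq (Fin.last n) L]
  rfl

theorem momentMap_complexify_graphOver (r : ℝ) (L₀ : Gr ℝ k n) (φ : Taut L₀ →L[ℝ] ℝ) :
    (complexify (graphOver r ⟨L₀, φ⟩)).momentMap (Fin.last n) =
      (r * ‖φ‖) ^ 2 / (1 + (r * ‖φ‖) ^ 2) := by
  rw [momentMap_complexify_eq_norm_sq]
  have h : ‖(graphOver r ⟨L₀, φ⟩).1.starProjection (lastVec n)‖ ^ 2 =
      ‖r • φ‖ ^ 2 / (1 + ‖r • φ‖ ^ 2) :=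
    norm_sq_starProjection_graph L₀.1 (r • φ) (graphOver r ⟨L₀, φ⟩).1 (fun y => mem_graphOver)
  rw [norm_smul, Real.norm_eq_abs, mul_pow, sq_abs, ← mul_pow] at h
  exact h

theorem lastVec_notMem {c : ℝ} (hc : c < 1) {L : Gr ℝ k (n + 1)} (hL : L ∈ realLevelSet k n c) :
    lastVec n ∉ L.1 := by
  intro h
  rw [mem_realLevelSet, Submodule.starProjection_eq_self_iff.2 h, norm_lastVec] at hL
  linarith

/-- The map `u ↦ u / (1 + u)` is injective for `u ≥ 0` and takes the value `c` at `u = c / (1 - c)`.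
This dictates the scaling factor of the graphs. -/
theorem div_one_add_sq_eq_iff {c s t : ℝ} (hc0 : 0 < c) (hc1 : c < 1) (hs : s ^ 2 = c / (1 - c))
    (ht : 0 ≤ t) : (s * t) ^ 2 / (1 + (s * t) ^ 2) = c ↔ t = 1 := by
  have h1 : (0 : ℝ) < 1 - c := by linarith
  rw [div_eq_iff (by positivity), mul_pow, hs, ← pow_eq_one_iff_of_nonneg ht two_ne_zero]
  field_simp
  constructor <;> intro h <;> nlinarith

theorem graphOver_mem_realLevelSet {c r : ℝ} (hc0 : 0 < c) (hc1 : c < 1)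
    (hr : r ^ 2 = c / (1 - c)) (p : DualTautTotal k n) :
    graphOver r p ∈ realLevelSet k n c ↔ p ∈ dualSphereBundle k n := by
  obtain ⟨L₀, φ⟩ := p
  change (complexify _).momentMap _ = c ↔ _
  rw [momentMap_complexify_graphOver, div_one_add_sq_eq_iff hc0 hc1 hr (norm_nonneg _)]
  rfl

theorem angleTo_eq (v : EuclideanSpace ℝ (Fin m)) (hv : ‖v‖ = 1) (L : Gr ℝ k m) :
    angleTo v L = Real.arccos ‖L.1.starProjection v‖ := by
  have h1 : inner ℝ v (L.1.starProjection v) = ‖L.1.starProjection v‖ ^ 2 := by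
    rw [← real_inner_self_eq_norm_sq, Submodule.inner_starProjection_left_eq_right,
      Submodule.starProjection_eq_self_iff.2 (Submodule.starProjection_apply_mem _ _)]
  rw [angleTo, InnerProductGeometry.angle, h1, hv, one_mul]
  congr 1
  -- If the projection is zero, the quotient is `0 / 0 = 0` and the angle is `arccos 0`, a right
  -- angle.
  rcases eq_or_ne ‖L.1.starProjection v‖ 0 with h | h
  · simp [h]
  · field_simp

theorem mem_realLevelSet_iff_angleTo {c : ℝ} (hc0 : 0 < c) (hc1 : c < 1) (L : Gr ℝ k (n + 1)) :
    L ∈ realLevelSet k n c ↔ angleTo (lastVec n) L = Real.arccos (Real.sqrt c) := by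
  have h1 : ‖L.1.starProjection (lastVec n)‖ ≤ 1 :=
    (L.1.norm_starProjection_apply_le _).trans norm_lastVec.le
  have h2 : Real.sqrt c ≤ 1 := Real.sqrt_le_one.2 hc1.le
  rw [mem_realLevelSet, angleTo_eq _ norm_lastVec,
    Real.arccos_inj (by linarith [norm_nonneg (L.1.starProjection (lastVec n))]) h1
      (by linarith [Real.sqrt_nonneg c]) h2, eq_comm (b := Real.sqrt c),
    Real.sqrt_eq_iff_eq_sq hc0.le (norm_nonneg _), eq_comm]

/-- The graph map restricts to a bijection from the unit sphere bundle onto the level set. -/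
theorem bijective_graphOver_restrict {c r : ℝ} (hc0 : 0 < c) (hc1 : c < 1)
    (hr : r ^ 2 = c / (1 - c)) :
    Function.Bijective fun p : dualSphereBundle k n =>
      (⟨graphOver r p.1, (graphOver_mem_realLevelSet hc0 hc1 hr p.1).2 p.2⟩ :
        realLevelSet k n c) := by
  have hr0 : r ≠ 0 := by
    rintro rfl
    have : 0 < c / (1 - c) := div_pos hc0 (by linarith)
    simp [← hr] at this
  constructor
  · intro p q h
    exact Subtype.ext (graphOver_injective hr0 (congrArg Subtype.val h))
  · rintro ⟨L, hL⟩
    obtain ⟨p, rfl⟩ := exists_graphOver_eq hr0 (lastVec_notMem hc1 hL)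
    exact ⟨⟨p, (graphOver_mem_realLevelSet hc0 hc1 hr p).1 hL⟩, rfl⟩

/-- Exactly two functionals of norm one on `S` vanish on a given hyperplane. -/
theorem exists_unit_functional {E : Type*} [NormedAddCommGroup E] [InnerProductSpace ℝ E]
    [FiniteDimensional ℝ E] (M : Submodule ℝ E)
    (hM : Module.finrank ℝ M + 1 = Module.finrank ℝ E) :
    ∃ φ : E →L[ℝ] ℝ, φ ≠ -φ ∧ ∀ ψ : E →L[ℝ] ℝ, (‖ψ‖ = 1 ∧ ∀ x ∈ M, ψ x = 0) ↔ ψ = φ ∨ ψ = -φ := by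
  have h1 : Module.finrank ℝ Mᗮ = 1 := by
    have := M.finrank_add_finrank_orthogonal
    omega
  -- By Riesz, functionals vanishing on `M` correspond to vectors of the line `Mᗮ`, which contains
  -- two unit vectors, `±w`.
  obtain ⟨⟨u, hu⟩, hu0, huM⟩ := finrank_eq_one_iff'.1 h1
  have hu1 : ‖u‖ ≠ 0 := norm_ne_zero_iff.2 fun h => hu0 (Subtype.ext h)
  set w : E := ‖u‖⁻¹ • u
  have hw : ‖w‖ = 1 := by rw [norm_smul, norm_inv, norm_norm, inv_mul_cancel₀ hu1]
  have hwM : w ∈ Mᗮ := Submodule.smul_mem _ _ hu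
  let D := InnerProductSpace.toDual ℝ E
  have hvan : ∀ x ∈ M, D w x = 0 := fun x hx => by
    rw [InnerProductSpace.toDual_apply_apply]
    exact Submodule.inner_left_of_mem_orthogonal hx hwM
  have hne : D w ≠ -D w := fun h => by
    have h0 : D w w = -D w w := DFunLike.congr_fun h w
    rw [InnerProductSpace.toDual_apply_apply, real_inner_self_eq_norm_sq, hw] at h0
    norm_num at h0
  refine ⟨D w, hne, fun ψ => ⟨fun ⟨h2, h3⟩ => ?_, ?_⟩⟩
  · obtain ⟨a, rfl⟩ := D.surjective ψ
    have ha : a ∈ Mᗮ := (Submodule.mem_orthogonal' _ _).2 fun x hx => by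
      rw [← InnerProductSpace.toDual_apply_apply (𝕜 := ℝ)]
      exact h3 x hx
    obtain ⟨t, ht⟩ := huM ⟨a, ha⟩
    have ht' : a = (t * ‖u‖) • w := by
      refine (congrArg Subtype.val ht).symm.trans ?_
      rw [mul_smul, smul_inv_smul₀ hu1]
      rfl
    have h4 : |t * ‖u‖| = 1 := by
      rw [D.norm_map, ht', norm_smul, hw, mul_one] at h2
      exact h2
    rcases eq_or_eq_neg_of_abs_eq h4 with h5 | h5
    · left; rw [ht', h5, one_smul]
    · right; rw [ht', h5, neg_smul, one_smul, map_neg]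
  · rintro (rfl | rfl)
    · exact ⟨by rw [D.norm_map, hw], hvan⟩
    · exact ⟨by rw [norm_neg, D.norm_map, hw], fun x hx => by simp [hvan x hx]⟩

end Gr

/-! ### Smooth coordinates on the Grassmannian and on the dual tautological bundle. -/

namespace Gr

variable {k m n : ℕ}

/-- A chart of the Grassmannian, as an open partial homeomorphism of its atlas. -/
def chartHomeo (e : Frame k m) : OpenPartialHomeomorph (Gr ℝ k m) (Model k m) :=
  (core k m).openPartialHomeomorph (chart e) ⟨e, rfl⟩

theorem chartHomeo_mem_maximalAtlas (e : Frame k m) :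
    chartHomeo e ∈ IsManifold.maximalAtlas 𝓘(ℝ, Model k m) ∞ (Gr ℝ k m) := by
  apply IsManifold.subset_maximalAtlas
  change _ ∈ ⋃ (e : PartialEquiv _ _) (he : e ∈ (core k m).atlas),
    {(core k m).openPartialHomeomorph e he}
  simp only [Set.mem_iUnion, Set.mem_singleton_iff]
  exact ⟨chart e, ⟨e, rfl⟩, rfl⟩

/-- This is the inverse of a chart, and the target of the chart is the whole model space. -/
theorem contMDiff_graphPt (e : Frame k m) :
    ContMDiff 𝓘(ℝ, Model k m) 𝓘(ℝ, Model k m) ∞ (graphPt e) :=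
  contMDiffOn_univ.1
    (contMDiffOn_symm_of_mem_maximalAtlas (chartHomeo_mem_maximalAtlas e))

/-! ### Smoothness of the moment map -/

/-- Passing to an orthonormal basis multiplies the sum by a squared determinant and yields 1. This
keeps the denominator of the moment map away from zero. -/
theorem sum_plucker_sq_ne_zero {L : Gr ℝ k m} (b : Module.Basis (Fin k) ℝ L.1) :
    ∑ I : Fin k ↪o Fin m, ‖plucker (fun a => (b a : EuclideanSpace ℝ (Fin m))) I‖ ^ 2 ≠ 0 := by
  let f : OrthonormalBasis (Fin k) ℝ L.1 :=
    (stdOrthonormalBasis ℝ L.1).reindex (finCongr L.2)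
  have hf : Orthonormal ℝ fun a => (f a : EuclideanSpace ℝ (Fin m)) :=
    f.orthonormal.comp_linearIsometry L.1.subtypeₗᵢ
  set C : Matrix (Fin k) (Fin k) ℝ := (b.toMatrix f).transpose
  have hb : (fun a => (f a : EuclideanSpace ℝ (Fin m))) =
      fun a => ∑ a', C a a' • (b a' : EuclideanSpace ℝ (Fin m)) := by
    funext a
    refine (congrArg Subtype.val (b.sum_toMatrix_smul_self f a)).symm.trans ?_
    rw [AddSubmonoidClass.coe_finsetSum]
    rfl
  have h := sum_plucker_sq hf
  rw [hb] at h
  simp only [plucker_sum_smul, mul_pow, ← Finset.mul_sum] at h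
  simp only [Real.norm_eq_abs, sq_abs]
  exact right_ne_zero_of_mul (h ▸ one_ne_zero)

/-- The basis of the graph of `A` that corresponds to the standard basis of `ℝ^k`. -/
def graphBasis (e : Frame k m) (A : Model k m) : Module.Basis (Fin k) ℝ (graphPt e A).1 :=
  (EuclideanSpace.basisFun (Fin k) ℝ).toBasis.map
    (LinearEquiv.ofInjective (graphMap e A).toLinearMap (graphMap_injective e A))

theorem coe_graphBasis (e : Frame k m) (A : Model k m) (a : Fin k) :
    (graphBasis e A a : EuclideanSpace ℝ (Fin m)) = graphMap e A (EuclideanSpace.single a 1) := by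
  change graphMap e A ((EuclideanSpace.basisFun (Fin k) ℝ).toBasis a) = _
  simp

theorem contDiff_plucker_graphBasis (e : Frame k m) (I : Fin k ↪o Fin m) :
    ContDiff ℝ ∞ fun A =>
      ‖plucker (fun a => (graphBasis e A a : EuclideanSpace ℝ (Fin m))) I‖ ^ 2 := by
  have h := contDiff_graphMap e
  have h1 : ∀ (y : EuclideanSpace ℝ (Fin k)) (j : Fin m),
      ContDiff ℝ ∞ fun A => graphMap e A y j := fun y j =>
    (EuclideanSpace.proj (𝕜 := ℝ) j).contDiff.comp
      (h.clm_apply contDiff_const)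
  simp only [coe_graphBasis, plucker, Real.norm_eq_abs, sq_abs, Matrix.det_apply', Matrix.of_apply]
  refine ContDiff.pow (ContDiff.sum fun σ _ => contDiff_const.mul (contDiff_prod fun a _ => ?_)) 2
  exact h1 _ _

/-- By basis independence the moment map may be computed from `graphBasis`, which depends smoothly
on `A`; the chosen `frame` need not. -/
theorem contDiff_momentMap_graphPt (e : Frame k m) (i : Fin m) :
    ContDiff ℝ ∞ fun A => (complexify (graphPt e A)).momentMap i := by
  classical
  simp only [fun A => momentMap_complexify i (graphPt e A) (graphBasis e A), pluckerShare]
  refine ContDiff.div (ContDiff.sum fun I _ => ?_)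
    (ContDiff.sum fun I _ => contDiff_plucker_graphBasis e I)
    fun A => sum_plucker_sq_ne_zero (graphBasis e A)
  split_ifs
  · exact contDiff_plucker_graphBasis e I
  · exact contDiff_const

theorem contMDiff_momentMap_complexify (i : Fin m) :
    ContMDiff 𝓘(ℝ, Model k m) 𝓘(ℝ, ℝ) ∞ fun L : Gr ℝ k m => (complexify L).momentMap i := by
  intro L
  have h1 := (contDiff_momentMap_graphPt (frameAt L) i).contMDiff.comp_contMDiffOn
    (contMDiffOn_chart (frameAt L))
  refine (h1.congr fun L' hL' => ?_).contMDiffAt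
    ((isOpen_chart_source (frameAt L)).mem_nhds (frameAt_spec L))
  simp only [Function.comp_apply]
  rw [graphPt_chart hL']

/-! ### Smoothness of the graph map -/

/-- Linear coordinates on `ℝ^{n+1}` obtained from linear coordinates on `ℝ^n` by adding the last
coordinate to the second block. -/
def frameSucc (J : (EuclideanSpace ℝ (Fin (n - k)) × ℝ) ≃L[ℝ] EuclideanSpace ℝ (Fin (n + 1 - k)))
    (e : Frame k n) : Frame k (n + 1) :=
  LinearEquiv.toContinuousLinearEquiv
    { toFun := fun z => incl n (e (z.1, (J.symm z.2).1)) + (J.symm z.2).2 • lastVec n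
      map_add' := fun z w => by
        have : (z.1 + w.1, (J.symm z.2).1 + (J.symm w.2).1) =
          (z.1, (J.symm z.2).1) + (w.1, (J.symm w.2).1) := rfl
        simp only [Prod.fst_add, Prod.snd_add, map_add, this, add_smul]
        abel
      map_smul' := fun a z => by
        have : (a • z.1, a • (J.symm z.2).1) = a • (z.1, (J.symm z.2).1) := rfl
        simp only [Prod.smul_fst, Prod.smul_snd, map_smul, this, smul_add, smul_smul,
          RingHom.id_apply, smul_eq_mul]
      invFun := fun y => ((e.symm (dropLast n y)).1,
        J ((e.symm (dropLast n y)).2, y (Fin.last n)))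
      left_inv := fun z => by simp
      right_inv := fun y => by simp [incl_dropLast_add] }

theorem frameSucc_apply
    (J : (EuclideanSpace ℝ (Fin (n - k)) × ℝ) ≃L[ℝ] EuclideanSpace ℝ (Fin (n + 1 - k)))
    (e : Frame k n) (y : EuclideanSpace ℝ (Fin k)) (z : EuclideanSpace ℝ (Fin (n - k))) (s : ℝ) :
    frameSucc J e (y, J (z, s)) = incl n (e (y, z)) + s • lastVec n := by
  change incl n (e (y, (J.symm (J (z, s))).1)) + (J.symm (J (z, s))).2 • lastVec n = _
  simp

/-- The graph map in coordinates. -/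
def modelSucc (J : (EuclideanSpace ℝ (Fin (n - k)) × ℝ) ≃L[ℝ] EuclideanSpace ℝ (Fin (n + 1 - k)))
    (r : ℝ) (q : Model k n × (EuclideanSpace ℝ (Fin k) →L[ℝ] ℝ)) : Model k (n + 1) :=
  J.toContinuousLinearMap ∘L (ContinuousLinearMap.inl ℝ _ ℝ ∘L q.1 +
    ContinuousLinearMap.inr ℝ (EuclideanSpace ℝ (Fin (n - k))) ℝ ∘L (r • q.2))

theorem modelSucc_apply
    (J : (EuclideanSpace ℝ (Fin (n - k)) × ℝ) ≃L[ℝ] EuclideanSpace ℝ (Fin (n + 1 - k)))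
    (r : ℝ) (q : Model k n × (EuclideanSpace ℝ (Fin k) →L[ℝ] ℝ)) (y : EuclideanSpace ℝ (Fin k)) :
    modelSucc J r q y = J (q.1 y, r * q.2 y) := by
  have : J (q.1 y, r * q.2 y) = J ((q.1 y, 0) + r • (0, q.2 y)) := by simp
  rw [this, map_add, map_smul]
  simp [modelSucc]

/-- The inverse of the graph map in coordinates. -/
def modelPred (J : (EuclideanSpace ℝ (Fin (n - k)) × ℝ) ≃L[ℝ] EuclideanSpace ℝ (Fin (n + 1 - k)))
    (r : ℝ) (B : Model k (n + 1)) : Model k n × (EuclideanSpace ℝ (Fin k) →L[ℝ] ℝ) :=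
  (ContinuousLinearMap.fst ℝ _ _ ∘L J.symm.toContinuousLinearMap ∘L B,
    r⁻¹ • (ContinuousLinearMap.snd ℝ _ _ ∘L J.symm.toContinuousLinearMap ∘L B))

theorem modelSucc_modelPred
    (J : (EuclideanSpace ℝ (Fin (n - k)) × ℝ) ≃L[ℝ] EuclideanSpace ℝ (Fin (n + 1 - k)))
    {r : ℝ} (hr : r ≠ 0) (B : Model k (n + 1)) : modelSucc J r (modelPred J r B) = B := by
  refine ContinuousLinearMap.ext fun y => ?_
  rw [modelSucc_apply]
  simp [modelPred, hr]

theorem contDiff_modelSucc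
    (J : (EuclideanSpace ℝ (Fin (n - k)) × ℝ) ≃L[ℝ] EuclideanSpace ℝ (Fin (n + 1 - k)))
    (r : ℝ) : ContDiff ℝ ∞ (modelSucc J r) := by
  unfold modelSucc
  fun_prop

theorem contDiff_modelPred
    (J : (EuclideanSpace ℝ (Fin (n - k)) × ℝ) ≃L[ℝ] EuclideanSpace ℝ (Fin (n + 1 - k)))
    (r : ℝ) : ContDiff ℝ ∞ (modelPred J r) := by
  unfold modelPred
  fun_prop

/-- The point of the graph over `e (y, A y)` is `e (y, A y) + r ψ(y) v_n`, so in these coordinates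
the graph map is the linear map `(A, ψ) ↦ J ∘ (A, r ψ)`. -/
theorem graphOver_eq_graphPt
    (J : (EuclideanSpace ℝ (Fin (n - k)) × ℝ) ≃L[ℝ] EuclideanSpace ℝ (Fin (n + 1 - k)))
    (r : ℝ) {e : Frame k n} {L₀ : Gr ℝ k n} (h : L₀ ∈ (chart e).source) (φ : Taut L₀ →L[ℝ] ℝ)
    (ψ : EuclideanSpace ℝ (Fin k) →L[ℝ] ℝ) (hψ : ∀ y, ψ y = φ (parFiber h y)) :
    graphOver r ⟨L₀, φ⟩ = graphPt (frameSucc J e) (modelSucc J r (chart e L₀, ψ)) := by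
  have key : ∀ y, incl n (parFiber h y).1 + (r * φ (parFiber h y)) • lastVec n =
      frameSucc J e (y, modelSucc J r (chart e L₀, ψ) y) := fun y => by
    rw [modelSucc_apply, frameSucc_apply, hψ]
    rfl
  apply Subtype.ext
  ext x
  rw [mem_graphOver, mem_graphPt_iff_exists, (parFiber h).surjective.exists]
  simp only [key]

/-- The preferred trivialisation of the dual tautological bundle near `L₁`. -/
abbrev dualTriv (L₁ : Gr ℝ k n) :=
  trivializationAt (EuclideanSpace ℝ (Fin k) →L[ℝ] ℝ) (DualTaut (k := k) (m := n)) L₁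

theorem dualTriv_baseSet (L₁ : Gr ℝ k n) :
    (dualTriv L₁).baseSet = (chart (frameAt L₁)).source := by
  rw [hom_trivializationAt_baseSet]
  exact Set.inter_univ _

/-- The trivialisation of a bundle of homomorphisms precomposes with the inverse trivialisation of
`τ`, which here is `parFiber`. -/
theorem dualTriv_apply {L₁ L₀ : Gr ℝ k n} (h : L₀ ∈ (chart (frameAt L₁)).source)
    (φ : Taut L₀ →L[ℝ] ℝ) (y : EuclideanSpace ℝ (Fin k)) :
    (dualTriv L₁ (⟨L₀, φ⟩ : DualTautTotal k n)).2 y = φ (parFiber h y) := by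
  have h1 : (trivializationAt (EuclideanSpace ℝ (Fin k)) (Taut (k := k) (m := n)) L₁).symmL ℝ L₀ y
      = parFiber h y := by
    rw [Bundle.Trivialization.symmL_apply _ h]
    exact tautTriv_symm h y
  rw [← h1, hom_trivializationAt_apply]
  simp [ContinuousLinearMap.inCoordinates]

theorem contMDiffOn_dualTriv_coord (L₁ : Gr ℝ k n) :
    ContMDiffOn (dualTautModel k n) 𝓘(ℝ, Model k n × (EuclideanSpace ℝ (Fin k) →L[ℝ] ℝ)) ∞
      (fun p : DualTautTotal k n => (chart (frameAt L₁) p.1, (dualTriv L₁ p).2))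
      (dualTriv L₁).source := by
  have hs : ∀ p ∈ (dualTriv L₁).source, p.1 ∈ (chart (frameAt L₁)).source := fun p hp => by
    rw [← dualTriv_baseSet]
    exact (dualTriv L₁).mem_source.1 hp
  have h1 := (contMDiffOn_chart (frameAt L₁)).comp
    ((Bundle.contMDiff_proj (n := ∞) (IB := 𝓘(ℝ, Model k n)) (DualTaut (k := k) (m := n))
      (F := EuclideanSpace ℝ (Fin k) →L[ℝ] ℝ)).contMDiffOn (s := (dualTriv L₁).source)) hs
  have h2 := (dualTriv L₁).contMDiffOn (IB := 𝓘(ℝ, Model k n)) (n := ∞)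
  exact h1.prodMk_space (contMDiff_snd.comp_contMDiffOn h2)

/-- The inverse of the coordinates given by `dualTriv`. -/
def dualParam (L₁ : Gr ℝ k n) (q : Model k n × (EuclideanSpace ℝ (Fin k) →L[ℝ] ℝ)) :
    DualTautTotal k n :=
  (dualTriv L₁).toPartialEquiv.symm (graphPt (frameAt L₁) q.1, q.2)

theorem contMDiff_dualParam (L₁ : Gr ℝ k n) :
    ContMDiff 𝓘(ℝ, Model k n × (EuclideanSpace ℝ (Fin k) →L[ℝ] ℝ)) (dualTautModel k n) ∞
      (dualParam L₁) := by
  have h1 := (dualTriv L₁).contMDiffOn_symm (IB := 𝓘(ℝ, Model k n)) (n := ∞)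
  rw [← contMDiffOn_univ]
  refine h1.comp (ContMDiff.contMDiffOn ?_) fun q _ => ?_
  · exact ((contMDiff_graphPt _).comp contDiff_fst.contMDiff).prodMk contDiff_snd.contMDiff
  · change (_, _) ∈ (dualTriv L₁).target
    rw [(dualTriv L₁).mem_target, dualTriv_baseSet]
    exact ⟨q.1, rfl⟩

theorem dualParam_coord {L₁ : Gr ℝ k n} {p : DualTautTotal k n}
    (hp : p.1 ∈ (chart (frameAt L₁)).source) :
    dualParam L₁ (chart (frameAt L₁) p.1, (dualTriv L₁ p).2) = p := by
  have hp' : p ∈ (dualTriv L₁).source := by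
    rw [(dualTriv L₁).mem_source, dualTriv_baseSet]
    exact hp
  unfold dualParam
  rw [graphPt_chart hp, (dualTriv L₁).mk_proj_snd hp']
  exact (dualTriv L₁).toPartialEquiv.left_inv hp'

theorem coord_dualParam (L₁ : Gr ℝ k n)
    (q : Model k n × (EuclideanSpace ℝ (Fin k) →L[ℝ] ℝ)) :
    (dualParam L₁ q).1 = graphPt (frameAt L₁) q.1 ∧ (dualTriv L₁ (dualParam L₁ q)).2 = q.2 := by
  have hq : (graphPt (frameAt L₁) q.1, q.2) ∈ (dualTriv L₁).target := by
    rw [(dualTriv L₁).mem_target, dualTriv_baseSet]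
    exact ⟨q.1, rfl⟩
  exact ⟨(dualTriv L₁).proj_symm_apply hq, congrArg Prod.snd ((dualTriv L₁).apply_symm_apply hq)⟩

theorem graphOver_eq_of_mem
    (J : (EuclideanSpace ℝ (Fin (n - k)) × ℝ) ≃L[ℝ] EuclideanSpace ℝ (Fin (n + 1 - k)))
    (r : ℝ) {L₁ : Gr ℝ k n} {p : DualTautTotal k n} (hp : p.1 ∈ (chart (frameAt L₁)).source) :
    graphOver r p = graphPt (frameSucc J (frameAt L₁))
      (modelSucc J r (chart (frameAt L₁) p.1, (dualTriv L₁ p).2)) := by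
  obtain ⟨L₀, φ⟩ := p
  exact graphOver_eq_graphPt J r hp φ _ fun y => dualTriv_apply hp φ y

theorem graphOver_dualParam
    (J : (EuclideanSpace ℝ (Fin (n - k)) × ℝ) ≃L[ℝ] EuclideanSpace ℝ (Fin (n + 1 - k)))
    (r : ℝ) (L₁ : Gr ℝ k n) (q : Model k n × (EuclideanSpace ℝ (Fin k) →L[ℝ] ℝ)) :
    graphOver r (dualParam L₁ q) = graphPt (frameSucc J (frameAt L₁)) (modelSucc J r q) := by
  obtain ⟨h1, h2⟩ := coord_dualParam L₁ q
  rw [graphOver_eq_of_mem J r (L₁ := L₁) (h1 ▸ ⟨q.1, rfl⟩), h2, h1, chart_graphPt]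

/-- With truncated subtraction, `n + 1 - k = (n - k) + 1` requires `k ≤ n`; the existence of `L₁`
guarantees it. -/
theorem nonempty_splitting (L₁ : Gr ℝ k n) :
    Nonempty ((EuclideanSpace ℝ (Fin (n - k)) × ℝ) ≃L[ℝ] EuclideanSpace ℝ (Fin (n + 1 - k))) := by
  have hk : k ≤ n := by
    have := L₁.1.finrank_le
    rwa [L₁.2, finrank_euclideanSpace_fin] at this
  refine ⟨ContinuousLinearEquiv.ofFinrankEq ?_⟩
  simp
  omega

theorem contMDiff_graphOver (r : ℝ) :
    ContMDiff (dualTautModel k n) 𝓘(ℝ, Model k (n + 1)) ∞ (graphOver (k := k) (n := n) r) := by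
  intro p₁
  obtain ⟨J⟩ := nonempty_splitting p₁.1
  have h := (contMDiff_graphPt (frameSucc J (frameAt p₁.1))).comp_contMDiffOn
    ((contDiff_modelSucc J r).contMDiff.comp_contMDiffOn (contMDiffOn_dualTriv_coord p₁.1))
  refine (h.congr fun p hp => ?_).contMDiffAt ((dualTriv p₁.1).open_source.mem_nhds ?_)
  · refine graphOver_eq_of_mem J r ?_
    rw [← dualTriv_baseSet]
    exact (dualTriv p₁.1).mem_source.1 hp
  · rw [(dualTriv p₁.1).mem_source, dualTriv_baseSet]
    exact frameAt_spec _

/-- The coordinate expression of the graph map is invertible, so its inverse read in the charts is a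
smooth left inverse. It provides the ambient smooth extension of the map from the level set to the
sphere bundle. -/
theorem exists_contMDiffOn_leftInverse_graphOver {r : ℝ} (hr : r ≠ 0) (p₁ : DualTautTotal k n) :
    ∃ V : Set (Gr ℝ k (n + 1)), IsOpen V ∧ graphOver r p₁ ∈ V ∧
      ∃ g : Gr ℝ k (n + 1) → DualTautTotal k n,
        ContMDiffOn 𝓘(ℝ, Model k (n + 1)) (dualTautModel k n) ∞ g V ∧
          ∀ p, graphOver r p ∈ V → g (graphOver r p) = p := by
  obtain ⟨J⟩ := nonempty_splitting p₁.1
  set e := frameSucc J (frameAt p₁.1)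
  refine ⟨(chart e).source, isOpen_chart_source e, ?_,
    dualParam p₁.1 ∘ modelPred J r ∘ chart e, ?_, ?_⟩
  · rw [graphOver_eq_of_mem J r (frameAt_spec p₁.1)]
    exact ⟨_, rfl⟩
  · exact (contMDiff_dualParam p₁.1).comp_contMDiffOn
      ((contDiff_modelPred J r).contMDiff.comp_contMDiffOn (contMDiffOn_chart e))
  · intro p hp
    -- By injectivity it suffices to compare the graphs, where `modelSucc` undoes `modelPred`.
    apply graphOver_injective hr
    simp only [Function.comp_apply]
    rw [graphOver_dualParam J, modelSucc_modelPred J hr, graphPt_chart hp]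

/-- These rays in the fibres cross the sphere bundle transversally at `s = 1`; they serve as test
curves for the differentials of the defining functions. -/
theorem contMDiff_smul_functional (L₀ : Gr ℝ k n) (φ : Taut L₀ →L[ℝ] ℝ) :
    ContMDiff 𝓘(ℝ, ℝ) (dualTautModel k n) ∞ fun s : ℝ => (⟨L₀, s • φ⟩ : DualTautTotal k n) := by
  have h : (fun s : ℝ => (⟨L₀, s • φ⟩ : DualTautTotal k n)) =
      fun s : ℝ => dualParam L₀ (chart (frameAt L₀) L₀, s • (dualTriv L₀ ⟨L₀, φ⟩).2) := by
    funext s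
    rw [← dualParam_coord (L₁ := L₀) (p := ⟨L₀, s • φ⟩) (frameAt_spec L₀)]
    congr 2
    refine ContinuousLinearMap.ext fun y => ?_
    rw [dualTriv_apply (frameAt_spec L₀), smul_apply,
      smul_apply, dualTriv_apply (frameAt_spec L₀)]
  rw [h]
  exact (contMDiff_dualParam L₀).comp
    (contDiff_const.prodMk (contDiff_id.smul contDiff_const)).contMDiff

end Gr

/-! ### Hypersurfaces, the diffeomorphism, and the count of subspaces. -/

theorem mfderiv_ne_zero_of_hasDerivAt {E H M : Type*} [NormedAddCommGroup E] [NormedSpace ℝ E]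
    [TopologicalSpace H] [TopologicalSpace M] [ChartedSpace H M] {I : ModelWithCorners ℝ E H}
    {h : M → ℝ} {γ : ℝ → M} {t d : ℝ} (hh : MDifferentiableAt I 𝓘(ℝ, ℝ) h (γ t))
    (hγ : MDifferentiableAt 𝓘(ℝ, ℝ) I γ t) (hd : HasDerivAt (fun s => h (γ s)) d t) (hd0 : d ≠ 0) :
    mfderiv I 𝓘(ℝ, ℝ) h (γ t) ≠ 0 := by
  intro h0
  have h1 := mfderiv_comp t hh hγ
  rw [h0, ContinuousLinearMap.zero_comp, mfderiv_eq_fderiv] at h1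
  have h2 : fderiv ℝ (h ∘ γ) t = 0 := h1
  have h3 := hd.deriv
  rw [← fderiv_apply_one_eq_deriv] at h3
  exact hd0 (h3.symm.trans (congrArg (fun T : ℝ →L[ℝ] ℝ => T 1) h2))

namespace Gr

variable {k n : ℕ}

/-- The function `F(μ_n) - c` on the real Grassmannian. -/
def levelFun (c : ℝ) (L : Gr ℝ k (n + 1)) : ℝ := (complexify L).momentMap (Fin.last n) - c

theorem contMDiff_levelFun (c : ℝ) :
    ContMDiff 𝓘(ℝ, Model k (n + 1)) 𝓘(ℝ, ℝ) ∞ (levelFun (k := k) (n := n) c) :=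
  (contDiff_id.sub contDiff_const).contMDiff.comp (contMDiff_momentMap_complexify (Fin.last n))

theorem levelFun_eq_zero {c : ℝ} {L : Gr ℝ k (n + 1)} :
    levelFun c L = 0 ↔ L ∈ realLevelSet k n c := sub_eq_zero

/-- Along the ray the function is `r² s² / (1 + r² s²) - c`. -/
theorem hasDerivAt_levelFun_graphOver {r : ℝ} (c : ℝ) {L₀ : Gr ℝ k n} {φ : Taut L₀ →L[ℝ] ℝ}
    (hφ : ‖φ‖ = 1) :
    HasDerivAt (fun s : ℝ => levelFun c (graphOver r ⟨L₀, s • φ⟩))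
      (2 * r ^ 2 / (1 + r ^ 2) ^ 2) 1 := by
  have h1 : (fun s : ℝ => levelFun c (graphOver r ⟨L₀, s • φ⟩)) =
      fun s : ℝ => r ^ 2 * s ^ 2 / (1 + r ^ 2 * s ^ 2) - c := by
    funext s
    rw [levelFun, momentMap_complexify_graphOver, norm_smul, hφ, mul_one, mul_pow,
      Real.norm_eq_abs, sq_abs]
  have h2 : HasDerivAt (fun s : ℝ => r ^ 2 * s ^ 2) (r ^ 2 * 2) 1 := by
    simpa using (hasDerivAt_pow 2 (1 : ℝ)).const_mul (r ^ 2)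
  have h3 := (h2.div (h2.const_add 1) (by positivity)).sub_const c
  rw [h1]
  exact h3.congr_deriv (by simp only [one_pow, mul_one]; ring)

theorem isSmoothHypersurface_realLevelSet {c : ℝ} (hc0 : 0 < c) (hc1 : c < 1) {r : ℝ} (hr0 : r ≠ 0)
    (hr : r ^ 2 = c / (1 - c)) :
    IsSmoothHypersurface 𝓘(ℝ, Model k (n + 1)) (realLevelSet k n c) := by
  intro L hL
  refine ⟨Set.univ, isOpen_univ, Set.mem_univ _, levelFun c, (contMDiff_levelFun c).contMDiffOn,
    ?_, ?_⟩
  · obtain ⟨⟨p, hp⟩, hpL⟩ := (bijective_graphOver_restrict hc0 hc1 hr).2 ⟨L, hL⟩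
    obtain rfl : graphOver r p = L := congrArg Subtype.val hpL
    obtain ⟨L₀, φ⟩ := p
    have h1 := mfderiv_ne_zero_of_hasDerivAt (t := 1)
      (γ := fun s : ℝ => graphOver r (⟨L₀, s • φ⟩ : DualTautTotal k n))
      ((contMDiff_levelFun c).mdifferentiable (by simp) _)
      (((contMDiff_graphOver r).comp (contMDiff_smul_functional L₀ φ)).mdifferentiable (by simp) 1)
      (hasDerivAt_levelFun_graphOver c hp) (by positivity)
    rw [one_smul] at h1
    exact h1
  · ext L'
    simp [levelFun_eq_zero]

/-- The defining function is the level function pulled back by the graph map, so smoothness of the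
fibre norm is not needed. The choice `r = 1`, `c = 1/2` satisfies `r² = c / (1 - c)`. -/
theorem isSmoothHypersurface_dualSphereBundle :
    IsSmoothHypersurface (dualTautModel k n) (dualSphereBundle k n) := by
  have hc : (1 : ℝ) ^ 2 = (1 / 2) / (1 - 1 / 2) := by norm_num
  have hsm := (contMDiff_levelFun (k := k) (n := n) (1 / 2)).comp (contMDiff_graphOver 1)
  rintro ⟨L₀, φ⟩ hp
  refine ⟨Set.univ, isOpen_univ, Set.mem_univ _, fun p => levelFun (1 / 2) (graphOver 1 p),
    hsm.contMDiffOn, ?_, ?_⟩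
  · have h1 := mfderiv_ne_zero_of_hasDerivAt (t := 1)
      (γ := fun s : ℝ => (⟨L₀, s • φ⟩ : DualTautTotal k n))
      (h := fun p => levelFun (1 / 2) (graphOver 1 p))
      (hsm.mdifferentiable (by simp) _)
      ((contMDiff_smul_functional L₀ φ).mdifferentiable (by simp) 1)
      (hasDerivAt_levelFun_graphOver (1 / 2) hp) (by norm_num)
    rw [one_smul] at h1
    exact h1
  · ext p
    simp only [Set.inter_univ, Set.mem_univ, true_and, Set.mem_ofPred_eq, levelFun_eq_zero,
      graphOver_mem_realLevelSet (by norm_num : (0 : ℝ) < 1 / 2) (by norm_num) hc]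

/-- The level set is in bijection with the unit sphere bundle, a subspace corresponding to the
functional it is the graph of. -/
def levelSetEquiv {c r : ℝ} (hc0 : 0 < c) (hc1 : c < 1) (hr : r ^ 2 = c / (1 - c)) :
    realLevelSet k n c ≃ dualSphereBundle k n :=
  (Equiv.ofBijective _ (bijective_graphOver_restrict hc0 hc1 hr)).symm

theorem graphOver_levelSetEquiv {c r : ℝ} (hc0 : 0 < c) (hc1 : c < 1) (hr : r ^ 2 = c / (1 - c))
    (L : realLevelSet k n c) : graphOver r (levelSetEquiv hc0 hc1 hr L).1 = L.1 :=
  congrArg Subtype.val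
    ((Equiv.ofBijective _ (bijective_graphOver_restrict hc0 hc1 hr)).apply_symm_apply L)

theorem isDiffeoBetween_levelSetEquiv {c r : ℝ} (hc0 : 0 < c) (hc1 : c < 1) (hr0 : r ≠ 0)
    (hr : r ^ 2 = c / (1 - c)) :
    IsDiffeoBetween 𝓘(ℝ, Model k (n + 1)) (dualTautModel k n)
      (levelSetEquiv (k := k) (n := n) hc0 hc1 hr) := by
  constructor
  · intro L
    obtain ⟨V, hV, hLV, g, hg, hgr⟩ :=
      exists_contMDiffOn_leftInverse_graphOver hr0 (levelSetEquiv hc0 hc1 hr L).1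
    rw [graphOver_levelSetEquiv] at hLV
    refine ⟨V, hV, hLV, g, hg, fun L' hL' => ?_⟩
    rw [← graphOver_levelSetEquiv hc0 hc1 hr L'] at hL' ⊢
    exact hgr _ hL'
  · exact fun p => ⟨Set.univ, isOpen_univ, Set.mem_univ _, graphOver r,
      (contMDiff_graphOver r).contMDiffOn, fun _ _ => rfl⟩

theorem map_dropLast_le {L₀ : Gr ℝ k n} {L : Gr ℝ k (n + 1)}
    (h : L.1 ≤ Submodule.span ℝ {lastVec n} ⊔ L₀.1.map (incl n)) :
    L.1.map (dropLast n) ≤ L₀.1 := by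
  refine (Submodule.map_mono h).trans ?_
  rw [Submodule.map_sup, Submodule.map_span, Set.image_singleton, dropLast_lastVec, sup_le_iff]
  refine ⟨by simp, ?_⟩
  rintro _ ⟨_, ⟨x, hx, rfl⟩, rfl⟩
  rwa [dropLast_incl]

/-- The subspaces in question are the graphs of the unit functionals on `L₀` that vanish on `M`, and
there are two of these. -/
theorem ncard_subspaces_containing {c : ℝ} (hc0 : 0 < c) (hc1 : c < 1) {r : ℝ} (hr0 : r ≠ 0)
    (hr : r ^ 2 = c / (1 - c)) (L₀ : Gr ℝ k n) (M : Submodule ℝ (EuclideanSpace ℝ (Fin n)))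
    (hM : M ≤ L₀.1) (hMk : Module.finrank ℝ M + 1 = k) :
    {L : Gr ℝ k (n + 1) |
      L.1 ≤ Submodule.span ℝ {lastVec n} ⊔ L₀.1.map (incl n) ∧
      M.map (incl n) ≤ L.1 ∧ L ∈ realLevelSet k n c}.ncard = 2 := by
  obtain ⟨φ, hφ0, hφ⟩ := exists_unit_functional (M.comap L₀.1.subtype) (by
    rw [(Submodule.comapSubtypeEquivOfLe hM).finrank_eq, hMk, L₀.2])
  have hvan : ∀ ψ : Taut L₀ →L[ℝ] ℝ, M.map (incl n) ≤ (graphOver r ⟨L₀, ψ⟩).1 ↔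
      ∀ x ∈ M.comap L₀.1.subtype, ψ x = 0 := by
    intro ψ
    rw [Submodule.map_le_iff_le_comap]
    constructor
    · intro h x hx
      exact (incl_mem_graphOver hr0 x).1 (h hx)
    · intro h x hx
      exact (incl_mem_graphOver hr0 ⟨x, hM hx⟩).2 (h ⟨x, hM hx⟩ hx)
  have hset : {L : Gr ℝ k (n + 1) |
      L.1 ≤ Submodule.span ℝ {lastVec n} ⊔ L₀.1.map (incl n) ∧
      M.map (incl n) ≤ L.1 ∧ L ∈ realLevelSet k n c} =
      {graphOver r ⟨L₀, φ⟩, graphOver r ⟨L₀, -φ⟩} := by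
    ext L
    simp only [Set.mem_ofPred_eq, Set.mem_insert_iff, Set.mem_singleton_iff]
    have hiff : ∀ ψ : Taut L₀ →L[ℝ] ℝ, (M.map (incl n) ≤ (graphOver r ⟨L₀, ψ⟩).1 ∧
        graphOver r ⟨L₀, ψ⟩ ∈ realLevelSet k n c) ↔ ψ = φ ∨ ψ = -φ := by
      intro ψ
      rw [hvan, graphOver_mem_realLevelSet hc0 hc1 hr, and_comm]
      exact hφ ψ
    constructor
    · rintro ⟨h1, h2⟩
      obtain ⟨⟨L₁, ψ⟩, rfl⟩ := exists_graphOver_eq hr0 (lastVec_notMem hc1 h2.2)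
      have h3 := map_dropLast_le h1
      rw [map_dropLast_graphOver] at h3
      -- The projection of `L` to `ℝ^n` lies in `L₀` and has the same dimension.
      obtain rfl : L₁ = L₀ :=
        Subtype.ext (Submodule.eq_of_le_of_finrank_eq h3 (L₁.2.trans L₀.2.symm))
      exact ((hiff ψ).1 h2).imp (fun h => by rw [h]) (fun h => by rw [h])
    · rintro (rfl | rfl)
      · exact ⟨graphOver_le r L₀ φ, (hiff φ).2 (Or.inl rfl)⟩
      · exact ⟨graphOver_le r L₀ (-φ), (hiff (-φ)).2 (Or.inr rfl)⟩
  rw [hset, Set.ncard_pair]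
  intro h
  have h1 := graphOver_injective hr0 h
  exact hφ0 (eq_of_heq (Bundle.TotalSpace.mk.inj h1).2)

end Gr

end

theorem mainTheorem2 (k n : ℕ) (c : ℝ) (hc0 : 0 < c) (hc1 : c < 1) :
    -- both sides are smooth hypersurfaces, and they are diffeomorphic over `Gr_ℝ(k, n)`
    IsSmoothHypersurface 𝓘(ℝ, Gr.Model k (n + 1)) (Gr.realLevelSet k n c) ∧
    IsSmoothHypersurface (Gr.dualTautModel k n) (Gr.dualSphereBundle k n) ∧
    (∃ Φ : Gr.realLevelSet k n c ≃ Gr.dualSphereBundle k n,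
      IsDiffeoBetween 𝓘(ℝ, Gr.Model k (n + 1)) (Gr.dualTautModel k n) Φ ∧
      ∀ (L : Gr.realLevelSet k n c) (L₀ : Gr ℝ k n) (φ : Gr.Taut L₀ →L[ℝ] ℝ),
        (Φ L : Gr.DualTautTotal k n) = ⟨L₀, φ⟩ →
          L.1.1 ≤ Submodule.span ℝ {Gr.lastVec n} ⊔ L₀.1.map (Gr.incl n) ∧
          ∀ x : Gr.Taut L₀, φ x = 0 ↔ Gr.incl n x.1 ∈ L.1.1) ∧
    -- membership in the level set prescribes the angle with `v_n`
    (∀ L : Gr ℝ k (n + 1), L ∈ Gr.realLevelSet k n c ↔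
      Gr.angleTo (Gr.lastVec n) L = Real.arccos (Real.sqrt c)) ∧
    -- exactly two subspaces with the prescribed angle contain a given hyperplane `M` of `L₀`
    (∀ (L₀ : Gr ℝ k n) (M : Submodule ℝ (EuclideanSpace ℝ (Fin n))),
      M ≤ L₀.1 → Module.finrank ℝ M + 1 = k →
        {L : Gr ℝ k (n + 1) |
          L.1 ≤ Submodule.span ℝ {Gr.lastVec n} ⊔ L₀.1.map (Gr.incl n) ∧
          M.map (Gr.incl n) ≤ L.1 ∧
          Gr.angleTo (Gr.lastVec n) L = Real.arccos (Real.sqrt c)}.ncard = 2) := by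
  -- The slope `r` is the one for which the graph of `r φ` with `‖φ‖ = 1` has moment value `c`.
  obtain ⟨r, hr0, hr⟩ : ∃ r : ℝ, r ≠ 0 ∧ r ^ 2 = c / (1 - c) := by
    have h : 0 < c / (1 - c) := div_pos hc0 (by linarith)
    exact ⟨Real.sqrt (c / (1 - c)), (Real.sqrt_pos.2 h).ne', Real.sq_sqrt h.le⟩
  refine ⟨Gr.isSmoothHypersurface_realLevelSet hc0 hc1 hr0 hr,
    Gr.isSmoothHypersurface_dualSphereBundle,
    ⟨Gr.levelSetEquiv hc0 hc1 hr, Gr.isDiffeoBetween_levelSetEquiv hc0 hc1 hr0 hr, ?_⟩,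
    Gr.mem_realLevelSet_iff_angleTo hc0 hc1, ?_⟩
  · intro L L₀ φ h
    rw [← Gr.graphOver_levelSetEquiv hc0 hc1 hr L, h]
    exact ⟨Gr.graphOver_le r L₀ φ, fun x => (Gr.incl_mem_graphOver hr0 x).symm⟩
  · intro L₀ M hM hMk
    simp only [← Gr.mem_realLevelSet_iff_angleTo hc0 hc1]
    exact Gr.ncard_subspaces_containing hc0 hc1 hr0 hr L₀ M hM hMk
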